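/- Let $B$ be a category. A morphism $g\colon e'\to e$ of a category $E$ with a functor $p\colon E\to B$ is $p$-cartesian if for every $g'\colon e''\to e$ and every $h\colon pe''\to pe'$ with $pg'=pg\cdot h$ there is a unique $k\colon e''\to e'$ with $pk=h$ and $g'=g\cdot k$; the functor $p$ is a fibration if every $f\colon b\to pe$ in $B$ has a $p$-cartesian lift with codomain $e$. Let $\mathbf{Fib}(B)$ be the 2-category of fibrations over $B$, of cartesian functors (functors commuting strictly with the projections to $B$ and preserving cartesian arrows) and of all natural transformations lying over the identity of $B$. Let $\mathbf{Psd}[B^{\mathrm{op}},\mathbf{Cat}]$ be the 2-category of pseudofunctors $B^{\mathrm{op}}\to\mathbf{Cat}$, pseudonatural transformations and modifications. Here the total categories of the fibrations and the categories in $\mathbf{Cat}$ range over the same universe of categories, which is large enough to contain $B$. There is a 2-equivalence of 2-categories $$\mathbf{Fib}(B)\simeq\mathbf{Psd}[B^{\mathrm{op}},\mathbf{Cat}],$$ that is, there are (strict) 2-functors in both directions whose two composites are 2-naturally isomorphic to the identity 2-functors. More precisely, such a 2-equivalence is given by the following two 2-functors. (i) $\mathbf{Fib}(B)\to\mathbf{Psd}[B^{\mathrm{op}},\mathbf{Cat}]$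 (fibers and reindexing). A fibration $E\to B$ is sent to the pseudofunctor $b\mapsto E_b$, $(f\colon b'\to b)\mapsto (f^*\colon E_b\to E_{b'})$, where $E_b$ is the fiber over $b$ (objects over $b$, morphisms over $1_b$), $f^*$ is given by chosen cartesian lifts $f^*x\to x$ of $f$, and the coherence isomorphisms are those induced by the universal property of the lifts. A cartesian functor $\Phi$ is sent to its restrictions to the fibers together with the induced isomorphisms $\Phi(f^*x)\cong f^*(\Phi x)$, and a 2-cell is sent to its restrictions to the fibers. (ii) $\mathbf{Psd}[B^{\mathrm{op}},\mathbf{Cat}]\to\mathbf{Fib}(B)$ (the Grothendieck construction). A pseudofunctor $F$ is sent to the projection to $B$ of the category with objects the pairs $(b,x)$, $b\in B$, $x\in F(b)$, and with morphisms $(b',x')\to(b,x)$ the pairs $(f,h)$ of $f\colon b'\to b$ in $B$ and $h\colon x'\to F(f)(x)$ in $F(b')$. A pseudonatural transformation $\alpha$ is sent to the functor $(b,x)\mapsto(b,\alpha_b(x))$, which sends $(f,h)$ to the pair of $f$ and the composite of $\alpha_{b'}(h)$ with the naturality isomorphism $\alpha_{b'}(F(f)(x))\cong G(f)(\alpha_b(x))$;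 a modification $\Gamma\colon\alpha\to\beta$ is sent to the 2-cell whose component at $(b,x)$ is the morphism over $1_b$ given by $\Gamma_{b,x}\colon\alpha_b(x)\to\beta_b(x)$. -/

import Mathlib

open CategoryTheory
open scoped CategoryTheory.Pseudofunctor.StrongTrans

universe v₁ v v₂ u₁ u u₂

namespace FibPsd

open Bicategory Opposite Pseudofunctor

/-- A (Grothendieck) fibration over `B`, i.e. an object of the 2-category `Fib(B)`: a category `obj` with a functor `p : obj ⥤ B` such that
every `f : b ⟶ p e` has a `p`-cartesian lift with codomain `e`. -/
structure Fibration (B : Type u₁) [Category.{v₁} B] extends BasedCategory.{v, u} B where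
  exists_cartesian_lift (e : obj) (b : B) (f : b ⟶ p.obj e) :
    ∃ (e' : obj) (g : e' ⟶ e), p.IsStronglyCartesian f g

variable {B : Type u₁} [Category.{v₁} B]

instance (E : Fibration.{v₁, v, u₁, u} B) : E.p.IsFibered :=
  Functor.IsFibered.of_exists_isStronglyCartesian E.exists_cartesian_lift

/-- A cartesian functor over `B`: a functor commuting strictly with the projections to `B` and
preserving cartesian arrows. -/
structure CartesianFunctor (E E' : Fibration.{v₁, v, u₁, u} B) extends
    BasedFunctor E.toBasedCategory E'.toBasedCategory where
  map_cartesian {R S : B} (f : R ⟶ S) {a b : E.obj} (φ : a ⟶ b) :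
    E.p.IsStronglyCartesian f φ → E'.p.IsStronglyCartesian f (toFunctor.map φ)

theorem CartesianFunctor.ext' {E E' : Fibration.{v₁, v, u₁, u} B} {F G : CartesianFunctor E E'}
    (h : F.toFunctor = G.toFunctor) : F = G := by
  obtain ⟨⟨F, _⟩, _⟩ := F
  obtain ⟨⟨G, _⟩, _⟩ := G
  obtain rfl : F = G := h
  rfl

instance : CategoryStruct (Fibration.{v₁, v, u₁, u} B) where
  Hom E E' := CartesianFunctor E E'
  id E := { BasedFunctor.id E.toBasedCategory with map_cartesian _ _ _ _ h := h }
  comp F G := { BasedFunctor.comp F.toBasedFunctor G.toBasedFunctor with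
    map_cartesian f _ _ _ h := G.map_cartesian f _ (F.map_cartesian f _ h) }

/-- The 2-cells `F ⟶ G` are all natural transformations lying over the identity of `B`. -/
instance (E E' : Fibration.{v₁, v, u₁, u} B) : Category (E ⟶ E') where
  Hom F G := BasedNatTrans F.toBasedFunctor G.toBasedFunctor
  id F := BasedNatTrans.id F.toBasedFunctor
  comp α β := BasedNatTrans.comp α β

/-- The underlying natural transformation of a 2-cell. -/
def toNT {E E' : Fibration.{v₁, v, u₁, u} B} {F G : E ⟶ E'} (α : F ⟶ G) :
    F.toFunctor ⟶ G.toFunctor := BasedNatTrans.toNatTrans α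

instance (E E' : Fibration.{v₁, v, u₁, u} B) (F G : E ⟶ E') (α : F ⟶ G) (a : E.obj) :
    E'.p.IsHomLift (𝟙 (E.p.obj a)) ((toNT α).app a) := BasedNatTrans.app_isHomLift α a

section
variable {E E' E'' E''' : Fibration.{v₁, v, u₁, u} B}

@[ext]
theorem hom₂_ext {F G : E ⟶ E'} {α β : F ⟶ G} (h : ∀ a, (toNT α).app a = (toNT β).app a) :
    α = β := BasedNatTrans.ext _ _ (NatTrans.ext (funext h))

@[simp] theorem id_toNT_app (F : E ⟶ E') (a : E.obj) :
    (toNT (𝟙 F)).app a = 𝟙 (F.toFunctor.obj a) := rfl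
@[simp] theorem comp_toNT_app {F G H : E ⟶ E'} (α : F ⟶ G) (β : G ⟶ H) (a : E.obj) :
    (toNT (α ≫ β)).app a = (toNT α).app a ≫ (toNT β).app a := rfl
@[simp] theorem id_toFunctor : (𝟙 E : E ⟶ E).toFunctor = 𝟭 E.obj := rfl
@[simp] theorem comp_toFunctor (F : E ⟶ E') (G : E' ⟶ E'') :
    (F ≫ G).toFunctor = F.toFunctor ⋙ G.toFunctor := rfl

end

/-- Composition is strictly associative and unital, and whiskering is that of natural
transformations. -/
instance : Bicategory (Fibration.{v₁, v, u₁, u} B) where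
  whiskerLeft F _ _ α := BasedCategory.whiskerLeft F.toBasedFunctor α
  whiskerRight α H := BasedCategory.whiskerRight α H.toBasedFunctor
  associator _ _ _ := Iso.refl _
  leftUnitor _ := Iso.refl _
  rightUnitor _ := Iso.refl _
  whiskerLeft_id f g := Bicategory.whiskerLeft_id (B := BasedCategory.{v, u} B) f.1 g.1
  whiskerLeft_comp f _ _ _ η θ :=
    Bicategory.whiskerLeft_comp (B := BasedCategory.{v, u} B) f.1 η θ
  id_whiskerLeft η := Bicategory.id_whiskerLeft (B := BasedCategory.{v, u} B) η
  comp_whiskerLeft f g _ _ η := Bicategory.comp_whiskerLeft (B := BasedCategory.{v, u} B) f.1 g.1 η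
  id_whiskerRight f g := Bicategory.id_whiskerRight (B := BasedCategory.{v, u} B) f.1 g.1
  comp_whiskerRight η θ i :=
    Bicategory.comp_whiskerRight (B := BasedCategory.{v, u} B) η θ i.1
  whiskerRight_id η := Bicategory.whiskerRight_id (B := BasedCategory.{v, u} B) η
  whiskerRight_comp η g h :=
    Bicategory.whiskerRight_comp (B := BasedCategory.{v, u} B) η g.1 h.1
  whisker_assoc f _ _ η h :=
    Bicategory.whisker_assoc (B := BasedCategory.{v, u} B) f.1 η h.1
  whisker_exchange η θ := Bicategory.whisker_exchange (B := BasedCategory.{v, u} B) η θ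
  pentagon f g h i := Bicategory.pentagon (B := BasedCategory.{v, u} B) f.1 g.1 h.1 i.1
  triangle f g := Bicategory.triangle (B := BasedCategory.{v, u} B) f.1 g.1

instance : Bicategory.Strict (Fibration.{v₁, v, u₁, u} B) where
  id_comp _ := rfl
  comp_id _ := rfl
  assoc _ _ _ := rfl
  leftUnitor_eqToIso _ := rfl
  rightUnitor_eqToIso _ := rfl
  associator_eqToIso _ _ _ := rfl

section
variable {E E' E'' : Fibration.{v₁, v, u₁, u} B}
@[simp] theorem whiskerLeft_toNT_app (F : E ⟶ E') {G H : E' ⟶ E''} (α : G ⟶ H) (a : E.obj) :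
    (toNT (F ◁ α)).app a = (toNT α).app (F.toFunctor.obj a) := rfl
@[simp] theorem whiskerRight_toNT_app {F G : E ⟶ E'} (α : F ⟶ G) (H : E' ⟶ E'') (a : E.obj) :
    (toNT (α ▷ H)).app a = H.toFunctor.map ((toNT α).app a) := rfl
theorem eqToHom_toNT_app {F G : E ⟶ E'} (h : F = G) (a : E.obj) :
    (toNT (eqToHom h)).app a = eqToHom (by rw [h]) := by
  subst h; rfl
end

/-- The 2-category of pseudofunctors `Bᵒᵖ ⥤ Cat`, pseudonatural transformations and
modifications. -/
abbrev Psd (B : Type u₁) [Category.{v₁} B] := Pseudofunctor (LocallyDiscrete Bᵒᵖ) Cat.{v, u}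

section
variable {F G H K : Psd.{v₁, v, u₁, u} B}

theorem strongTrans_ext {η θ : F ⟶ G} (h : ∀ a, (η.app a).toFunctor = (θ.app a).toFunctor)
    (h' : ∀ {a b : LocallyDiscrete Bᵒᵖ} (f : a ⟶ b) (x : F.obj a),
      (η.naturality f).hom.toNatTrans.app x ≫ eqToHom (by simp [h]) =
      eqToHom (by simp [h]) ≫ (θ.naturality f).hom.toNatTrans.app x) : η = θ := by
  obtain ⟨p, n, _, _, _⟩ := η
  obtain ⟨q, m, _, _, _⟩ := θ
  obtain rfl : p = q := funext fun a => Cat.ext (h a)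
  have : @n = @m := by
    funext a b f
    ext x
    simpa using h' f x
  subst this
  rfl

theorem modification_eqToHom_app {η θ : F ⟶ G} (h : η = θ)
    (a : LocallyDiscrete Bᵒᵖ) (x : F.obj a) :
    ((eqToHom h).as.app a).toNatTrans.app x = eqToHom (by rw [h]) := by
  subst h; rfl

theorem id_naturality_app {a b : LocallyDiscrete Bᵒᵖ} (f : a ⟶ b) (x : F.obj a) :
    (StrongTrans.naturality (𝟙 F) f).hom.toNatTrans.app x = 𝟙 ((F.map f).toFunctor.obj x) := by
  exact Category.id_comp _

theorem comp_naturality_app (η : F ⟶ G) (θ : G ⟶ H) {a b : LocallyDiscrete Bᵒᵖ}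
    (f : a ⟶ b) (x : F.obj a) :
    (StrongTrans.naturality (η ≫ θ) f).hom.toNatTrans.app x =
      (θ.app b).toFunctor.map ((η.naturality f).hom.toNatTrans.app x) ≫
        (θ.naturality f).hom.toNatTrans.app ((η.app a).toFunctor.obj x) := by
  rw [StrongTrans.categoryStruct_comp_naturality_hom]
  exact (Category.id_comp _).trans (congrArg _ ((Category.id_comp _).trans (Category.comp_id _)))

theorem strict_id_comp (f : F ⟶ G) : 𝟙 F ≫ f = f := by
  apply strongTrans_ext
  · intro a b g x
    refine (Category.comp_id _).trans (Eq.trans ?_ (Category.id_comp _).symm)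
    rw [comp_naturality_app, id_naturality_app]
    exact (congrArg (· ≫ _) ((f.app b).toFunctor.map_id _)).trans (Category.id_comp _)
  · intro a; rfl

theorem strict_comp_id (f : F ⟶ G) : f ≫ 𝟙 G = f := by
  apply strongTrans_ext
  · intro a b g x
    refine (Category.comp_id _).trans (Eq.trans ?_ (Category.id_comp _).symm)
    rw [comp_naturality_app, id_naturality_app]
    exact Category.comp_id _
  · intro a; rfl

theorem strict_assoc (f : F ⟶ G) (g : G ⟶ H) (h : H ⟶ K) : (f ≫ g) ≫ h = f ≫ g ≫ h := by
  apply strongTrans_ext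
  · intro a b k x
    refine (Category.comp_id _).trans (Eq.trans ?_ (Category.id_comp _).symm)
    simp only [comp_naturality_app]
    exact (congrArg (· ≫ _) ((h.app b).toFunctor.map_comp _ _)).trans (Category.assoc _ _ _)
  · intro a; rfl

end

instance : Bicategory.Strict (Psd.{v₁, v, u₁, u} B) where
  id_comp := strict_id_comp
  comp_id := strict_comp_id
  assoc := strict_assoc
  leftUnitor_eqToIso f := by
    ext a x
    refine Eq.trans ?_ (modification_eqToHom_app (strict_id_comp f) a x).symm
    rfl
  rightUnitor_eqToIso f := by
    ext a x
    refine Eq.trans ?_ (modification_eqToHom_app (strict_comp_id f) a x).symm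
    rfl
  associator_eqToIso f g h := by
    ext a x
    refine Eq.trans ?_ (modification_eqToHom_app (strict_assoc f g h) a x).symm
    rfl

section Grothendieck

open CoGrothendieck

variable {F G H : Psd.{v₁, v, u₁, u} B}

/-- The morphism `(f, h)` of the Grothendieck construction. -/
def grHom {X Y : CoGrothendieck F} (f : X.base ⟶ Y.base)
    (h : X.fiber ⟶ (F.map f.op.toLoc).toFunctor.obj Y.fiber) : X ⟶ Y :=
  CoGrothendieck.Hom.mk f h

/-- A morphism of the category `F R`, as a vertical morphism of the Grothendieck construction. -/
def grVert {R : B} {x x' : F.obj ⟨op R⟩} (w : x ⟶ x') :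
    CoGrothendieck.mk R x ⟶ CoGrothendieck.mk R x' :=
  (ι F R).map w

/-- The cartesian lift `(f, 1)`. -/
def grLift (Y : CoGrothendieck F) {R : B} (f : R ⟶ Y.base) :
    CoGrothendieck.mk R ((F.map f.op.toLoc).toFunctor.obj Y.fiber) ⟶ Y :=
  cartesianLift Y.fiber f

theorem grVert_comp {R : B} {x x' : F.obj ⟨op R⟩} (w : x ⟶ x') {Y : CoGrothendieck F}
    (f : R ⟶ Y.base) (h : x' ⟶ (F.map f.op.toLoc).toFunctor.obj Y.fiber) :
    grVert w ≫ grHom (X := ⟨R, x'⟩) f h = grHom (X := ⟨R, x⟩) f (w ≫ h) := by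
  refine CoGrothendieck.Hom.ext _ _ (Category.id_comp f) ?_
  have e := CoGrothendieck.Hom.congr (Category.id_comp (grHom (X := ⟨R, x'⟩) (Y := Y) f h))
  refine (Category.assoc _ _ _).trans ((congrArg (w ≫ ·) e).trans (Category.assoc _ _ _).symm)

theorem comp_grVert {S : B} {y y' : F.obj ⟨op S⟩} (w : y ⟶ y') {X : CoGrothendieck F}
    (f : X.base ⟶ S) (h : X.fiber ⟶ (F.map f.op.toLoc).toFunctor.obj y) :
    grHom (Y := ⟨S, y⟩) f h ≫ grVert w =
      grHom (Y := ⟨S, y'⟩) f (h ≫ (F.map f.op.toLoc).toFunctor.map w) := by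
  refine CoGrothendieck.Hom.ext _ _ (Category.comp_id f) ?_
  have e := CoGrothendieck.Hom.congr
    (Category.comp_id (grHom (X := X) (Y := ⟨S, y'⟩) f (h ≫ (F.map f.op.toLoc).toFunctor.map w)))
  refine Eq.trans ?_ e
  refine (congrArg (h ≫ ·) ?_).trans (Category.assoc _ _ _).symm
  exact (congrArg (· ≫ _) ((F.map f.op.toLoc).toFunctor.map_comp _ _)).trans
    (Category.assoc _ _ _)

theorem map_grVert (α : F ⟶ G) {S : B} {y y' : F.obj ⟨op S⟩} (w : y ⟶ y') :
    (CoGrothendieck.map α).map (grVert w) = grVert ((α.app ⟨op S⟩).toFunctor.map w) := by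
  refine CoGrothendieck.Hom.ext _ _ rfl ?_
  have e := CoGrothendieck.Hom.congr
    ((CoGrothendieck.map α).map_id (⟨S, y'⟩ : CoGrothendieck F))
  refine Eq.trans ?_ ((congrArg ((α.app ⟨op S⟩).toFunctor.map w ≫ ·) e).trans
    (Category.assoc _ _ _).symm)
  exact (congrArg (· ≫ _) ((α.app ⟨op S⟩).toFunctor.map_comp _ _)).trans
    (Category.assoc _ _ _)

theorem grVert_id {R : B} (x : F.obj ⟨op R⟩) :
    grVert (𝟙 x) = 𝟙 (CoGrothendieck.mk R x) := (ι F R).map_id x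

theorem grVert_comp_grVert {R : B} {x y z : F.obj ⟨op R⟩} (w : x ⟶ y) (w' : y ⟶ z) :
    grVert (w ≫ w') = grVert w ≫ grVert w' := (ι F R).map_comp w w'

instance grVert_isHomLift (R : B) {x x' : F.obj ⟨op R⟩} (w : x ⟶ x') :
    (forget F).IsHomLift (𝟙 R) (grVert w) :=
  CategoryTheory.IsHomLift.map (forget F) (grVert w)

instance grVert_isIso (R : B) {x x' : F.obj ⟨op R⟩} (w : x ⟶ x') [IsIso w] : IsIso (grVert w) :=
  inferInstanceAs (IsIso ((ι F R).map w))

instance grLift_cartesian (Y : CoGrothendieck F) {R : B} (f : R ⟶ Y.base) :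
    (forget F).IsStronglyCartesian f (grLift Y f) :=
  isStronglyCartesian_homCartesianLift Y.fiber f

theorem grVert_comp_grLift {X Y : CoGrothendieck F} (φ : X ⟶ Y) :
    grVert φ.fiber ≫ grLift Y φ.base = φ :=
  (grVert_comp φ.fiber φ.base (𝟙 _)).trans
    (congrArg (grHom φ.base) (Category.comp_id φ.fiber))

theorem isStronglyCartesian_of_isIso_fiber {X Y : CoGrothendieck F} (φ : X ⟶ Y)
    (h : IsIso φ.fiber) : (forget F).IsStronglyCartesian φ.base φ := by
  have h₂ : (forget F).IsStronglyCartesian (𝟙 X.base) (grVert φ.fiber) :=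
    Functor.IsStronglyCartesian.of_isIso _ _ _
  have h₃ := Functor.IsStronglyCartesian.comp (forget F) (f := 𝟙 X.base) (g := φ.base)
    (φ := grVert φ.fiber) (ψ := grLift Y φ.base)
  rwa [Category.id_comp, grVert_comp_grLift] at h₃

theorem map_isStronglyCartesian (α : F ⟶ G) {R S : B} (f : R ⟶ S) {X Y : CoGrothendieck F}
    (φ : X ⟶ Y) (hφ : (forget F).IsStronglyCartesian f φ) :
    (forget G).IsStronglyCartesian f ((CoGrothendieck.map α).map φ) := by
  obtain rfl : X.base = R := CategoryTheory.IsHomLift.domain_eq (forget F) f φ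
  obtain rfl : Y.base = S := CategoryTheory.IsHomLift.codomain_eq (forget F) f φ
  have h₀ : (forget F).IsHomLift f φ := hφ.toIsHomLift
  obtain rfl : f = φ.base := @CategoryTheory.IsHomLift.eq_of_isHomLift _ _ _ _ (forget F) _ _ f φ h₀
  have h₂ : (forget F).IsStronglyCartesian (𝟙 X.base) (grVert φ.fiber) := by
    have : (forget F).IsStronglyCartesian (𝟙 X.base ≫ φ.base)
        (grVert φ.fiber ≫ grLift Y φ.base) := by
      rw [Category.id_comp, grVert_comp_grLift]
      exact hφ
    exact Functor.IsStronglyCartesian.of_comp (forget F) (g := φ.base) (ψ := grLift Y φ.base)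
  have h₃ : IsIso (grVert φ.fiber) :=
    Functor.IsStronglyCartesian.isIso_of_base_isIso (forget F) (𝟙 X.base) _
  have h₄ : (forget G).IsStronglyCartesian (𝟙 X.base)
      ((CoGrothendieck.map α).map (grVert φ.fiber)) := by
    have : (forget G).IsHomLift (𝟙 X.base)
      ((CoGrothendieck.map α).map (grVert φ.fiber)) := by
      rw [map_grVert]; exact grVert_isHomLift _ _
    exact Functor.IsStronglyCartesian.of_isIso _ _ _
  have h₅ : (forget G).IsStronglyCartesian φ.base
      ((CoGrothendieck.map α).map (grLift Y φ.base)) := by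
    refine isStronglyCartesian_of_isIso_fiber ((CoGrothendieck.map α).map (grLift Y φ.base)) ?_
    have h₆ : IsIso ((α.naturality φ.base.op.toLoc).hom.toNatTrans.app Y.fiber) :=
      (Cat.Hom.toNatIso (α.naturality φ.base.op.toLoc)).app Y.fiber |>.isIso_hom
    have h₇ : IsIso ((α.app ⟨op X.base⟩).toFunctor.map
      (𝟙 ((F.map φ.base.op.toLoc).toFunctor.obj Y.fiber))) := inferInstance
    exact IsIso.comp_isIso' h₇ h₆
  have h₈ := @Functor.IsStronglyCartesian.comp _ _ _ _ (forget G) _ _ _ _ _ _ (𝟙 X.base) φ.base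
    ((CoGrothendieck.map α).map (grVert φ.fiber))
    ((CoGrothendieck.map α).map (grLift Y φ.base)) h₄ h₅
  rwa [Category.id_comp, ← Functor.map_comp, grVert_comp_grLift] at h₈

/-- The Grothendieck construction of a pseudofunctor, as a fibration over `B`. -/
def grothendieckObj (F : Psd.{v₁, v, u₁, u} B) :
    Fibration.{v₁, max v₁ v, u₁, max u₁ u} B where
  toBasedCategory := BasedCategory.ofFunctor (forget F)
  exists_cartesian_lift e _ f :=
    ⟨domainCartesianLift e.fiber f, cartesianLift e.fiber f,
      isStronglyCartesian_homCartesianLift e.fiber f⟩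

/-- The cartesian functor induced by a pseudonatural transformation. -/
def grothendieckMap (α : F ⟶ G) : grothendieckObj F ⟶ grothendieckObj G where
  toFunctor := CoGrothendieck.map α
  w := rfl
  map_cartesian f _ _ φ h := map_isStronglyCartesian α f φ h

theorem modification_naturality_app {α β : F ⟶ G} (Γ : α ⟶ β) {a b : LocallyDiscrete Bᵒᵖ}
    (f : a ⟶ b) (x : F.obj a) :
    (Γ.as.app b).toNatTrans.app ((F.map f).toFunctor.obj x) ≫
        (β.naturality f).hom.toNatTrans.app x =
      (α.naturality f).hom.toNatTrans.app x ≫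
        (G.map f).toFunctor.map ((Γ.as.app a).toNatTrans.app x) :=
  congrArg (fun t => t.toNatTrans.app x) (Γ.as.naturality f)

/-- The 2-cell induced by a modification: its component at `(b, x)` is the vertical morphism
`Γ_b x`. -/
def grothendieckMap₂ {α β : F ⟶ G} (Γ : α ⟶ β) : grothendieckMap α ⟶ grothendieckMap β where
  app X := grVert ((Γ.as.app ⟨op X.base⟩).toNatTrans.app X.fiber)
  naturality X Y φ := by
    refine (comp_grVert _ _ _).trans (Eq.trans ?_ (grVert_comp _ _ _).symm)
    refine congrArg (grHom (X := ⟨X.base, (α.app ⟨op X.base⟩).toFunctor.obj X.fiber⟩)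
      (Y := ⟨Y.base, (β.app ⟨op Y.base⟩).toFunctor.obj Y.fiber⟩) φ.base) ?_
    have h := modification_naturality_app Γ φ.base.op.toLoc Y.fiber
    have h' := (Γ.as.app ⟨op X.base⟩).toNatTrans.naturality φ.fiber
    refine (Category.assoc _ _ _).trans ((congrArg (_ ≫ ·) h.symm).trans ?_)
    refine (Category.assoc _ _ _).symm.trans ((congrArg (· ≫ _) h').trans ?_)
    exact Category.assoc _ _ _
  isHomLift' X := grVert_isHomLift _ _

variable (B) in
/-- The Grothendieck construction as a (strict) 2-functor. -/
def grothendieck :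
    StrictPseudofunctor (Psd.{v₁, v, u₁, u} B) (Fibration.{v₁, max v₁ v, u₁, max u₁ u} B) :=
  StrictPseudofunctor.mk''
  { obj := grothendieckObj
    map := grothendieckMap
    map₂ := grothendieckMap₂
    map₂_id := by
      intro F G α
      exact hom₂_ext fun X => grVert_id _
    map₂_comp := by
      intro F G α β γ Γ Γ'
      exact hom₂_ext fun X => grVert_comp_grVert _ _
    map_id F := CartesianFunctor.ext' (CoGrothendieck.map_id_eq F)
    map_comp α β := CartesianFunctor.ext' (CoGrothendieck.map_comp_eq α β)
    map₂_whisker_left := by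
      intro F G H α β γ Γ
      refine hom₂_ext fun X => ?_
      simp only [comp_toNT_app, eqToHom_toNT_app]
      exact ((Category.id_comp _).trans (Category.comp_id _)).symm
    map₂_whisker_right := by
      intro F G H α β Γ γ
      refine hom₂_ext fun X => ?_
      simp only [comp_toNT_app, eqToHom_toNT_app]
      refine Eq.trans ?_ ((Category.id_comp _).trans (Category.comp_id _)).symm
      exact (map_grVert γ _).symm }

end Grothendieck

section Fibers

open Functor.IsPreFibered

variable {E E' E'' : Fibration.{v₁, v, u₁, u} B}

/-- The fiber of `E` over `b`: objects of `E` over `b` and morphisms over `𝟙 b`. -/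
abbrev FiberCat (E : Fibration.{v₁, v, u₁, u} B) (b : B) := Functor.Fiber E.p b

/-- The underlying object of an object of a fiber. -/
def und {b : B} (x : FiberCat E b) : E.obj := x.1

/-- The underlying morphism of a morphism of a fiber. -/
def uh {b : B} {x y : FiberCat E b} (w : x ⟶ y) : und x ⟶ und y := w.1

theorem und_over {b : B} (x : FiberCat E b) : E.p.obj (und x) = b := x.2

instance uh_isHomLift {b : B} {x y : FiberCat E b} (w : x ⟶ y) : E.p.IsHomLift (𝟙 b) (uh w) := w.2

/-- A morphism over `𝟙 b`, as a morphism of the fiber. -/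
def fibMk {b : B} {x y : FiberCat E b} (w : und x ⟶ und y) [h : E.p.IsHomLift (𝟙 b) w] : x ⟶ y :=
  ⟨w, h⟩

@[simp] theorem uh_fibMk {b : B} {x y : FiberCat E b} (w : und x ⟶ und y)
    [h : E.p.IsHomLift (𝟙 b) w] : uh (fibMk w) = w := rfl

theorem fib_hom_ext {b : B} {x y : FiberCat E b} {w w' : x ⟶ y} (h : uh w = uh w') : w = w' :=
  Subtype.ext h

@[simp] theorem uh_comp {b : B} {x y z : FiberCat E b} (w : x ⟶ y) (w' : y ⟶ z) :
    uh (w ≫ w') = uh w ≫ uh w' := rfl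

@[simp] theorem uh_id {b : B} (x : FiberCat E b) : uh (𝟙 x) = 𝟙 (und x) := rfl

/-- The reindexed object `f^* x` in the fiber over `b'`, for `f : b' ⟶ b` and `x` over `b`: the
domain of a chosen cartesian lift of `f`. -/
noncomputable def pb {b' b : B} (f : b' ⟶ b) (x : FiberCat E b) : FiberCat E b' :=
  ⟨pullbackObj (und_over x) f, pullbackObj_proj (und_over x) f⟩

/-- The chosen cartesian lift `f^* x ⟶ x` of `f`. -/
noncomputable def lift {b' b : B} (f : b' ⟶ b) (x : FiberCat E b) : und (pb f x) ⟶ und x :=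
  pullbackMap (und_over x) f

instance lift_cartesian {b' b : B} (f : b' ⟶ b) (x : FiberCat E b) :
    E.p.IsStronglyCartesian f (lift f x) :=
  inferInstanceAs (E.p.IsStronglyCartesian f (pullbackMap (und_over x) f))

theorem lift_cancel {b' b : B} {f : b' ⟶ b} {x : FiberCat E b} {y : FiberCat E b'} {w w' : y ⟶ pb f x}
    (h : uh w ≫ lift f x = uh w' ≫ lift f x) : w = w' :=
  fib_hom_ext (Functor.IsCartesian.ext E.p f (lift f x) (uh w) (uh w') h)

theorem lift_cancel₂ {b'' b' b : B} {g : b'' ⟶ b'} {f : b' ⟶ b} {x : FiberCat E b} {y : FiberCat E b''}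
    {w w' : y ⟶ pb g (pb f x)}
    (h : uh w ≫ lift g (pb f x) ≫ lift f x = uh w' ≫ lift g (pb f x) ≫ lift f x) : w = w' :=
  fib_hom_ext
    (Functor.IsCartesian.ext E.p (g ≫ f) (lift g (pb f x) ≫ lift f x) (uh w) (uh w') h)

/-- The vertical isomorphism between the domain of a cartesian arrow over `f` and `f^* x`. -/
noncomputable def pbIso {b' b : B} (f : b' ⟶ b) {x : FiberCat E b} {y : FiberCat E b'} (k : und y ⟶ und x)
    [E.p.IsStronglyCartesian f k] : y ≅ pb f x where
  hom := fibMk (Functor.IsCartesian.map E.p f (lift f x) k)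
  inv := fibMk (Functor.IsCartesian.map E.p f k (lift f x))
  hom_inv_id := fib_hom_ext (Functor.IsCartesian.ext E.p f k _ _ (by simp))
  inv_hom_id := lift_cancel (by simp)

@[simp]
theorem pbIso_hom_lift {b' b : B} (f : b' ⟶ b) {x : FiberCat E b} {y : FiberCat E b'} (k : und y ⟶ und x)
    [E.p.IsStronglyCartesian f k] : uh (pbIso f k).hom ≫ lift f x = k :=
  Functor.IsCartesian.fac E.p f (lift f x) k

@[simp]
theorem pbIso_inv_comp {b' b : B} (f : b' ⟶ b) {x : FiberCat E b} {y : FiberCat E b'} (k : und y ⟶ und x)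
    [E.p.IsStronglyCartesian f k] : uh (pbIso f k).inv ≫ k = lift f x :=
  Functor.IsCartesian.fac E.p f k (lift f x)

@[simp]
theorem pbIso_hom_lift_assoc {b' b : B} (f : b' ⟶ b) {x : FiberCat E b} {y : FiberCat E b'}
    (k : und y ⟶ und x) [E.p.IsStronglyCartesian f k] {z : E.obj} (h : und x ⟶ z) :
    uh (pbIso f k).hom ≫ lift f x ≫ h = k ≫ h := by
  rw [← Category.assoc, pbIso_hom_lift]

@[simp]
theorem pbIso_inv_comp_assoc {b' b : B} (f : b' ⟶ b) {x : FiberCat E b} {y : FiberCat E b'}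
    (k : und y ⟶ und x) [E.p.IsStronglyCartesian f k] {z : E.obj} (h : und x ⟶ z) :
    uh (pbIso f k).inv ≫ k ≫ h = lift f x ≫ h := by
  rw [← Category.assoc, pbIso_inv_comp]

/-- The action of `f^*` on a morphism `w` of the fiber: the unique vertical morphism over `w`. -/
noncomputable def pbMap {b' b : B} (f : b' ⟶ b) {x y : FiberCat E b} (w : x ⟶ y) : pb f x ⟶ pb f y :=
  fibMk (Functor.IsCartesian.map E.p f (lift f y) (lift f x ≫ uh w))

@[simp]
theorem pbMap_lift {b' b : B} (f : b' ⟶ b) {x y : FiberCat E b} (w : x ⟶ y) :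
    uh (pbMap f w) ≫ lift f y = lift f x ≫ uh w :=
  Functor.IsCartesian.fac E.p f (lift f y) (lift f x ≫ uh w)

@[simp]
theorem pbMap_lift_assoc {b' b : B} (f : b' ⟶ b) {x y : FiberCat E b} (w : x ⟶ y) {z : E.obj}
    (h : und y ⟶ z) : uh (pbMap f w) ≫ lift f y ≫ h = lift f x ≫ uh w ≫ h := by
  rw [← Category.assoc, pbMap_lift, Category.assoc]

/-- The reindexing functor `f^*` between fibers. -/
noncomputable def reindex (E : Fibration.{v₁, v, u₁, u} B) {b' b : B} (f : b' ⟶ b) :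
    FiberCat E b ⥤ FiberCat E b' where
  obj x := pb f x
  map w := pbMap f w
  map_id x := lift_cancel (by simp)
  map_comp w w' := lift_cancel (by simp)

instance id_cartesian {b : B} (x : FiberCat E b) : E.p.IsStronglyCartesian (𝟙 b) (𝟙 (und x)) := by
  have : E.p.IsHomLift (𝟙 b) (𝟙 (und x)) := CategoryTheory.IsHomLift.id (und_over x)
  exact Functor.IsStronglyCartesian.of_isIso _ _ _

/-- The component `(𝟙 b)^* x ≅ x` of the unit constraint: the chosen cartesian lift of `𝟙 b`. -/
noncomputable def pbId (b : B) (x : FiberCat E b) : pb (𝟙 b) x ≅ x := (pbIso (𝟙 b) (𝟙 (und x))).symm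

@[simp] theorem uh_pbId_hom (b : B) (x : FiberCat E b) : uh (pbId b x).hom = lift (𝟙 b) x :=
  (Category.comp_id _).symm.trans (pbIso_inv_comp (𝟙 b) (𝟙 (und x)))

/-- The component `(g ≫ f)^* x ≅ g^* f^* x` of the composition constraint. -/
noncomputable def pbComp {b'' b' b : B} (g : b'' ⟶ b') (f : b' ⟶ b) (x : FiberCat E b) :
    pb (g ≫ f) x ≅ pb g (pb f x) :=
  (pbIso (g ≫ f) (lift g (pb f x) ≫ lift f x)).symm

@[simp]
theorem pbComp_hom_lift {b'' b' b : B} (g : b'' ⟶ b') (f : b' ⟶ b) (x : FiberCat E b) :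
    uh (pbComp g f x).hom ≫ lift g (pb f x) ≫ lift f x = lift (g ≫ f) x :=
  pbIso_inv_comp (g ≫ f) (lift g (pb f x) ≫ lift f x)

@[simp]
theorem pbComp_inv_lift {b'' b' b : B} (g : b'' ⟶ b') (f : b' ⟶ b) (x : FiberCat E b) :
    uh (pbComp g f x).inv ≫ lift (g ≫ f) x = lift g (pb f x) ≫ lift f x :=
  pbIso_hom_lift (g ≫ f) (lift g (pb f x) ≫ lift f x)

@[simp]
theorem pbComp_hom_lift_assoc {b'' b' b : B} (g : b'' ⟶ b') (f : b' ⟶ b) (x : FiberCat E b)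
    {z : E.obj} (h : und x ⟶ z) :
    uh (pbComp g f x).hom ≫ lift g (pb f x) ≫ lift f x ≫ h = lift (g ≫ f) x ≫ h := by
  rw [← pbComp_hom_lift g f x, Category.assoc, Category.assoc]

@[simp]
theorem pbComp_inv_lift_assoc {b'' b' b : B} (g : b'' ⟶ b') (f : b' ⟶ b) (x : FiberCat E b)
    {z : E.obj} (h : und x ⟶ z) :
    uh (pbComp g f x).inv ≫ lift (g ≫ f) x ≫ h = lift g (pb f x) ≫ lift f x ≫ h := by
  rw [← Category.assoc, pbComp_inv_lift, Category.assoc]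

theorem pbId_naturality {b : B} {x y : FiberCat E b} (w : x ⟶ y) :
    pbMap (𝟙 b) w ≫ (pbId b y).hom = (pbId b x).hom ≫ w :=
  fib_hom_ext (by simp)

theorem pbComp_naturality {b'' b' b : B} (g : b'' ⟶ b') (f : b' ⟶ b) {x y : FiberCat E b}
    (w : x ⟶ y) :
    pbMap (g ≫ f) w ≫ (pbComp g f y).hom = (pbComp g f x).hom ≫ pbMap g (pbMap f w) :=
  lift_cancel₂ (by simp)

/-- The unit constraint `(𝟙 b)^* ≅ 𝟭`. -/
noncomputable def reindexId (E : Fibration.{v₁, v, u₁, u} B) (b : B) :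
    reindex E (𝟙 b) ≅ 𝟭 (FiberCat E b) :=
  NatIso.ofComponents (fun x => pbId b x) (fun w => pbId_naturality w)

/-- The composition constraint `(g ≫ f)^* ≅ g^* f^*`. -/
noncomputable def reindexComp (E : Fibration.{v₁, v, u₁, u} B) {b'' b' b : B}
    (g : b'' ⟶ b') (f : b' ⟶ b) :
    reindex E (g ≫ f) ≅ reindex E f ⋙ reindex E g :=
  NatIso.ofComponents (fun x => pbComp g f x) (fun w => pbComp_naturality g f w)

theorem eqToHom_lift {b' b : B} {f f' : b' ⟶ b} (h : f = f') (x : FiberCat E b)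
    (h' : pb f x = pb f' x) : uh (eqToHom h') ≫ lift f' x = lift f x := by
  subst h; simp

theorem fibers_assoc {b₀ b₁ b₂ b₃ : B} (f : b₁ ⟶ b₀) (g : b₂ ⟶ b₁) (h : b₃ ⟶ b₂)
    (x : FiberCat E b₀) :
    uh ((pbComp h (g ≫ f) x).hom ≫ pbMap h (pbComp g f x).hom ≫
      𝟙 _ ≫ (pbComp h g (pb f x)).inv ≫ (pbComp (h ≫ g) f x).inv) ≫
      lift ((h ≫ g) ≫ f) x = lift (h ≫ g ≫ f) x := by
  simp

theorem fibers_left_unit {b₀ b₁ : B} (f : b₁ ⟶ b₀) (x : FiberCat E b₀) :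
    uh ((pbComp f (𝟙 b₀) x).hom ≫ pbMap f (pbId b₀ x).hom ≫ 𝟙 _) ≫ lift f x =
      lift (f ≫ 𝟙 b₀) x := by
  simp

theorem fibers_right_unit {b₀ b₁ : B} (f : b₁ ⟶ b₀) (x : FiberCat E b₀) :
    uh ((pbComp (𝟙 b₁) f x).hom ≫ (pbId b₁ (pb f x)).hom ≫ 𝟙 _) ≫ lift f x =
      lift (𝟙 b₁ ≫ f) x := by
  simp

/-- The pseudofunctor `b ↦ E_b`, `f ↦ f^*` of a fibration. -/
noncomputable def fibersObj (E : Fibration.{v₁, v, u₁, u} B) : Psd.{v₁, v, u₁, u} B :=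
  LocallyDiscrete.mkPseudofunctor
    (fun b => Cat.of (FiberCat E b.unop))
    (fun f => (reindex E f.unop).toCatHom)
    (fun b => Cat.Hom.isoMk (reindexId E b.unop))
    (fun f g => Cat.Hom.isoMk (reindexComp E g.unop f.unop))
    (by
      intro b₀ b₁ b₂ b₃ f g h
      ext x
      refine Eq.trans ?_ (Cat.eqToHom_app _ _ _ x).symm
      refine lift_cancel ?_
      refine Eq.trans ?_ (eqToHom_lift (by simp) x _).symm
      exact fibers_assoc f.unop g.unop h.unop x)
    (by
      intro b₀ b₁ f
      ext x
      refine Eq.trans ?_ (Cat.eqToHom_app _ _ _ x).symm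
      refine lift_cancel ?_
      refine Eq.trans ?_ (eqToHom_lift (by simp) x _).symm
      exact fibers_left_unit f.unop x)
    (by
      intro b₀ b₁ f
      ext x
      refine Eq.trans ?_ (Cat.eqToHom_app _ _ _ x).symm
      refine lift_cancel ?_
      refine Eq.trans ?_ (eqToHom_lift (by simp) x _).symm
      exact fibers_right_unit f.unop x)

/-- The restriction `E_b ⥤ E'_b` of a functor over `B` to the fibers. -/
def fiberMap (Φ : E ⟶ E') (b : B) : FiberCat E b ⥤ FiberCat E' b where
  obj x := ⟨Φ.toFunctor.obj (und x), (Φ.toBasedFunctor.w_obj _).trans (und_over x)⟩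
  map w := ⟨Φ.toFunctor.map (uh w), Φ.toBasedFunctor.preserves_isHomLift _ _⟩
  map_id x := fib_hom_ext (Φ.toFunctor.map_id (und x))
  map_comp w w' := fib_hom_ext (Φ.toFunctor.map_comp (uh w) (uh w'))

theorem und_fiberMap (Φ : E ⟶ E') {b : B} (x : FiberCat E b) :
    und ((fiberMap Φ b).obj x) = Φ.toFunctor.obj (und x) := rfl

/-- The image under `Φ` of a morphism between underlying objects. -/
def fiberImg (Φ : E ⟶ E') {b b' : B} {y : FiberCat E b'} {x : FiberCat E b} (k : und y ⟶ und x) :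
    und ((fiberMap Φ b').obj y) ⟶ und ((fiberMap Φ b).obj x) := Φ.toFunctor.map k

@[simp] theorem uh_fiberMap (Φ : E ⟶ E') {b : B} {x y : FiberCat E b} (w : x ⟶ y) :
    uh ((fiberMap Φ b).map w) = fiberImg Φ (uh w) := rfl

theorem fiberImg_comp (Φ : E ⟶ E') {b b' b'' : B} {z : FiberCat E b''} {y : FiberCat E b'}
    {x : FiberCat E b} (k : und z ⟶ und y) (l : und y ⟶ und x) :
    fiberImg Φ k ≫ fiberImg Φ l = fiberImg Φ (k ≫ l) := (Φ.toFunctor.map_comp k l).symm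

instance fiberImg_cartesian (Φ : E ⟶ E') {b b' : B} (f : b' ⟶ b) {y : FiberCat E b'} {x : FiberCat E b}
    (k : und y ⟶ und x) [h : E.p.IsStronglyCartesian f k] :
    E'.p.IsStronglyCartesian f (fiberImg Φ k) :=
  Φ.map_cartesian f k h

/-- The comparison `Φ (f^* x) ≅ f^* (Φ x)`. -/
noncomputable def comparison (Φ : E ⟶ E') {b' b : B} (f : b' ⟶ b) (x : FiberCat E b) :
    (fiberMap Φ b').obj (pb f x) ≅ pb f ((fiberMap Φ b).obj x) :=
  pbIso f (fiberImg Φ (lift f x))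

@[simp]
theorem comparison_hom_lift (Φ : E ⟶ E') {b' b : B} (f : b' ⟶ b) (x : FiberCat E b) :
    uh (comparison Φ f x).hom ≫ lift f ((fiberMap Φ b).obj x) = fiberImg Φ (lift f x) :=
  pbIso_hom_lift f (fiberImg Φ (lift f x))

@[simp]
theorem comparison_hom_lift_assoc (Φ : E ⟶ E') {b' b : B} (f : b' ⟶ b) (x : FiberCat E b)
    {z : E'.obj} (h : und ((fiberMap Φ b).obj x) ⟶ z) :
    uh (comparison Φ f x).hom ≫ lift f ((fiberMap Φ b).obj x) ≫ h =
      fiberImg Φ (lift f x) ≫ h := by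
  rw [← Category.assoc, comparison_hom_lift]

theorem comparison_naturality (Φ : E ⟶ E') {b' b : B} (f : b' ⟶ b) {x y : FiberCat E b}
    (w : x ⟶ y) :
    (fiberMap Φ b').map (pbMap f w) ≫ (comparison Φ f y).hom =
      (comparison Φ f x).hom ≫ pbMap f ((fiberMap Φ b).map w) :=
  lift_cancel (by simp [fiberImg_comp])

/-- The comparisons `Φ (f^* x) ≅ f^* (Φ x)`, natural in `x`. -/
noncomputable def comparisonIso (Φ : E ⟶ E') {b' b : B} (f : b' ⟶ b) :
    reindex E f ⋙ fiberMap Φ b' ≅ fiberMap Φ b ⋙ reindex E' f :=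
  NatIso.ofComponents (fun x => comparison Φ f x) (fun w => comparison_naturality Φ f w)

theorem comparison_id (Φ : E ⟶ E') (b : B) (x : FiberCat E b) :
    (comparison Φ (𝟙 b) x).hom ≫ (pbId b ((fiberMap Φ b).obj x)).hom =
      (fiberMap Φ b).map (pbId b x).hom :=
  fib_hom_ext (by simp)

theorem comparison_comp (Φ : E ⟶ E') {b₀ b₁ b₂ : B} (f : b₁ ⟶ b₀) (g : b₂ ⟶ b₁)
    (x : FiberCat E b₀) :
    (comparison Φ (g ≫ f) x).hom ≫ (pbComp g f ((fiberMap Φ b₀).obj x)).hom =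
      (fiberMap Φ b₂).map (pbComp g f x).hom ≫ (comparison Φ g (pb f x)).hom ≫
        pbMap g (comparison Φ f x).hom :=
  lift_cancel₂ (by simp [fiberImg_comp])

theorem map₂_id_app (F : Psd.{v₁, v, u₁, u} B) {a b : LocallyDiscrete Bᵒᵖ} (f : a ⟶ b)
    (x : F.obj a) : (F.map₂ (𝟙 f)).toNatTrans.app x = 𝟙 _ := by
  rw [F.map₂_id]; rfl

/-- The pseudonatural transformation induced by a cartesian functor: restriction to fibers, with
the comparisons `Φ (f^* x) ≅ f^* (Φ x)`. -/
noncomputable def fibersMap (Φ : E ⟶ E') : fibersObj E ⟶ fibersObj E' where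
  app b := (fiberMap Φ b.as.unop).toCatHom
  naturality f := Cat.Hom.isoMk (comparisonIso Φ f.as.unop)
  naturality_naturality {a b f g} η := by
    obtain rfl : f = g := LocallyDiscrete.eq_of_hom η
    obtain rfl : η = 𝟙 f := Subsingleton.elim _ _
    ext x
    refine Eq.trans (b := (comparison Φ f.as.unop x).hom) ?_ ?_
    · refine (congrArg (· ≫ (comparison Φ f.as.unop x).hom) ?_).trans (Category.id_comp _)
      exact (congrArg (fiberMap Φ b.as.unop).map (map₂_id_app (fibersObj E) f x)).trans
        ((fiberMap Φ b.as.unop).map_id _)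
    · exact ((congrArg ((comparison Φ f.as.unop x).hom ≫ ·)
        (map₂_id_app (fibersObj E') f _)).trans (Category.comp_id _)).symm
  naturality_id a := by
    ext x
    refine (comparison_id Φ a.as.unop x).trans ?_
    refine ((congrArg (_ ≫ ·) ?_).trans (Category.comp_id _)).symm
    exact Category.comp_id _
  naturality_comp {a b c} f g := by
    ext x
    refine (comparison_comp Φ f.as.unop g.as.unop x).trans ?_
    refine congrArg (_ ≫ ·) (Eq.symm ?_)
    refine (Category.id_comp _).trans (congrArg (_ ≫ ·) ?_)
    exact (Category.id_comp _).trans (Category.comp_id _)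

/-- The component of a 2-cell, as a morphism between underlying objects of fibers. -/
def vert {Φ Ψ : E ⟶ E'} (α : Φ ⟶ Ψ) {b : B} (x : FiberCat E b) :
    und ((fiberMap Φ b).obj x) ⟶ und ((fiberMap Ψ b).obj x) := (toNT α).app (und x)

theorem vert_naturality {Φ Ψ : E ⟶ E'} (α : Φ ⟶ Ψ) {b b' : B} {y : FiberCat E b'} {x : FiberCat E b}
    (k : und y ⟶ und x) :
    fiberImg Φ k ≫ vert α x = vert α y ≫ fiberImg Ψ k :=
  (toNT α).naturality k

/-- The restriction of a 2-cell to the fibers. -/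
def fiberMap₂ {Φ Ψ : E ⟶ E'} (α : Φ ⟶ Ψ) (b : B) : fiberMap Φ b ⟶ fiberMap Ψ b where
  app x := ⟨(toNT α).app (und x), BasedNatTrans.isHomLift α (und_over x)⟩
  naturality _ _ w := fib_hom_ext ((toNT α).naturality (uh w))

@[simp] theorem uh_fiberMap₂ {Φ Ψ : E ⟶ E'} (α : Φ ⟶ Ψ) {b : B} (x : FiberCat E b) :
    uh ((fiberMap₂ α b).app x) = vert α x := rfl

theorem fiberMap₂_comparison {Φ Ψ : E ⟶ E'} (α : Φ ⟶ Ψ) {b b' : B} (f : b' ⟶ b)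
    (x : FiberCat E b) :
    (fiberMap₂ α b').app (pb f x) ≫ (comparison Ψ f x).hom =
      (comparison Φ f x).hom ≫ pbMap f ((fiberMap₂ α b).app x) :=
  lift_cancel (by simp [vert_naturality])

/-- The modification induced by a 2-cell: restriction to fibers. -/
def fibersMap₂ {Φ Ψ : E ⟶ E'} (α : Φ ⟶ Ψ) : fibersMap Φ ⟶ fibersMap Ψ where
  as :=
  { app b := (fiberMap₂ α b.as.unop).toCatHom₂
    naturality f := by
      ext x
      exact fiberMap₂_comparison α f.as.unop x }

theorem comparison_of_id {b' b : B} (f : b' ⟶ b) (x : FiberCat E b) :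
    (comparison (𝟙 E) f x).hom = 𝟙 (pb f x) :=
  lift_cancel ((comparison_hom_lift (𝟙 E) f x).trans (Category.id_comp _).symm)

theorem comparison_of_comp_aux (Φ : E ⟶ E') (Ψ : E' ⟶ E'') {b' b : B} (f : b' ⟶ b)
    (x : FiberCat E b) :
    uh ((fiberMap Ψ b').map (comparison Φ f x).hom ≫
        (comparison Ψ f ((fiberMap Φ b).obj x)).hom) ≫
      lift f ((fiberMap Ψ b).obj ((fiberMap Φ b).obj x)) =
        fiberImg Ψ (fiberImg Φ (lift f x)) := by
  simp [fiberImg_comp]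

theorem comparison_of_comp (Φ : E ⟶ E') (Ψ : E' ⟶ E'') {b' b : B} (f : b' ⟶ b) (x : FiberCat E b) :
    (comparison (Φ ≫ Ψ) f x).hom =
      (fiberMap Ψ b').map (comparison Φ f x).hom ≫
        (comparison Ψ f ((fiberMap Φ b).obj x)).hom :=
  lift_cancel ((comparison_hom_lift (Φ ≫ Ψ) f x).trans
    (comparison_of_comp_aux Φ Ψ f x).symm)

theorem fibersMap_id (E : Fibration.{v₁, v, u₁, u} B) : fibersMap (𝟙 E) = 𝟙 (fibersObj E) := by
  refine strongTrans_ext (fun _ => rfl) ?_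
  intro a b f x
  refine (Category.comp_id _).trans (Eq.trans ?_ (Category.id_comp _).symm)
  rw [id_naturality_app]
  exact comparison_of_id f.as.unop x

theorem fibersMap_comp (Φ : E ⟶ E') (Ψ : E' ⟶ E'') :
    fibersMap (Φ ≫ Ψ) = fibersMap Φ ≫ fibersMap Ψ := by
  refine strongTrans_ext (fun _ => rfl) ?_
  intro a b f x
  refine (Category.comp_id _).trans (Eq.trans ?_ (Category.id_comp _).symm)
  rw [comp_naturality_app]
  exact comparison_of_comp Φ Ψ f.as.unop x

theorem modification_ext {F G : Psd.{v₁, v, u₁, u} B} {η θ : F ⟶ G} {Γ Γ' : η ⟶ θ}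
    (h : ∀ (b) (x : F.obj b), (Γ.as.app b).toNatTrans.app x = (Γ'.as.app b).toNatTrans.app x) :
    Γ = Γ' := by
  ext b x
  exact h b x

theorem modification_comp_app {F G : Psd.{v₁, v, u₁, u} B} {η θ κ : F ⟶ G} (Γ : η ⟶ θ)
    (Γ' : θ ⟶ κ) (b) (x : F.obj b) :
    ((Γ ≫ Γ').as.app b).toNatTrans.app x =
      (Γ.as.app b).toNatTrans.app x ≫ (Γ'.as.app b).toNatTrans.app x := rfl

variable (B) in
/-- Fibers and reindexing, as a (strict) 2-functor. -/
noncomputable def fibers :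
    StrictPseudofunctor (Fibration.{v₁, v, u₁, u} B) (Psd.{v₁, v, u₁, u} B) :=
  StrictPseudofunctor.mk''
  { obj := fibersObj
    map := fibersMap
    map₂ := fibersMap₂
    map₂_id := by
      intro E E' Φ
      exact modification_ext fun b x => rfl
    map₂_comp := by
      intro E E' Φ Ψ Χ α β
      exact modification_ext fun b x => rfl
    map_id := fibersMap_id
    map_comp := fibersMap_comp
    map₂_whisker_left := by
      intro E E' E'' Φ Ψ Χ α
      refine modification_ext fun b x => ?_
      simp only [modification_comp_app, modification_eqToHom_app]
      exact ((Category.id_comp _).trans (Category.comp_id _)).symm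
    map₂_whisker_right := by
      intro E E' E'' Φ Ψ α Χ
      refine modification_ext fun b x => ?_
      simp only [modification_comp_app, modification_eqToHom_app]
      exact ((Category.id_comp _).trans (Category.comp_id _)).symm }

end Fibers

section TwoEquivalence

universe w w' x x' y y'

variable {C : Type x} [Bicategory.{w, y} C] {D : Type x'} [Bicategory.{w', y'} D]

/-- A 2-natural transformation between 2-functors: a family of 1-cells strictly natural with
respect to 1-cells and 2-cells. -/
structure TwoNatTrans (F G : StrictPseudofunctor C D) where
  app (a : C) : F.obj a ⟶ G.obj a
  naturality {a b : C} (f : a ⟶ b) : F.map f ≫ app b = app a ≫ G.map f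
  naturality₂ {a b : C} {f g : a ⟶ b} (η : f ⟶ g) :
    F.map₂ η ▷ app b ≫ eqToHom (naturality g) = eqToHom (naturality f) ≫ app a ◁ G.map₂ η

/-- A 2-natural isomorphism between 2-functors. -/
structure TwoNatIso (F G : StrictPseudofunctor C D) where
  hom : TwoNatTrans F G
  inv : TwoNatTrans G F
  hom_inv_id (a : C) : hom.app a ≫ inv.app a = 𝟙 (F.obj a)
  inv_hom_id (a : C) : inv.app a ≫ hom.app a = 𝟙 (G.obj a)

variable (C D) in
/-- A 2-equivalence between 2-categories, i.e. an equivalence of `Cat`-enriched categories: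
2-functors in both directions, with both composites 2-naturally isomorphic to the identity. -/
structure TwoEquivalence [Strict C] [Strict D] where
  functor : StrictPseudofunctor C D
  inverse : StrictPseudofunctor D C
  unitIso : TwoNatIso (StrictPseudofunctor.id C) (functor.comp inverse)
  counitIso : TwoNatIso (inverse.comp functor) (StrictPseudofunctor.id D)

end TwoEquivalence

end FibPsd

/-!
For a fibration `E` there is a functor over `B` from the Grothendieck construction of the fibers of
`E` to `E`, sending `(b, x)` to `x` and `(f, h)` to the composite of the vertical arrow `h` with the
chosen lift of `f` (`grFibers`). It is bijective on objects, since an object `x` of `E` lies over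
exactly one `b`, and fully faithful, since every arrow over `f` factors uniquely through the chosen
lift of `f`. So it is an isomorphism of categories over `B`, and then both it and its inverse
preserve cartesian arrows (`isStronglyCartesian_map`).

For a pseudofunctor `F`, the functor `x ↦ (b, x)` is an isomorphism from `F b` to the fiber over `b`
of the Grothendieck construction of `F`. The canonical cartesian arrows `(f, 1)` differ from
the chosen lifts by unique vertical isomorphisms, which make these functors into a pseudonatural
transformation (`toFibers`). A pseudonatural transformation whose components are isomorphisms of
categories has a strict inverse (`strongTransInverse`).

Both families are strictly 2-natural, with equations between 1-cells that hold definitionally on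
objects. The inverse directions are less pleasant, since they transport objects along equalities
such as `p x = b`; their 2-naturality is therefore deduced formally from that of the given
families, in any strict bicategory (`TwoNatIso.ofInv`).

The universes `max v₁ v₂` and `max u₁ u₂` are of the form for which the Grothendieck construction
does not leave the universe of the pseudofunctor.
-/

namespace FibPsd

open Bicategory Opposite Pseudofunctor

/-! ### 2-natural isomorphisms between 2-functors -/

section Strict

universe w w' x x' y y'

variable {C : Type x} [Bicategory.{w, y} C] {D : Type x'} [Bicategory.{w', y'} D]

section
variable [Strict D] {a b c d : D}

theorem whiskerLeft_heq (f : a ⟶ b) {g g' h h' : b ⟶ c} {η : g ⟶ h} {η' : g' ⟶ h'}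
    (e : g = g') (e' : h = h') (k : η ≍ η') : f ◁ η ≍ f ◁ η' := by
  subst e e'; rw [eq_of_heq k]

theorem whiskerRight_heq {g g' h h' : a ⟶ b} {η : g ⟶ h} {η' : g' ⟶ h'}
    (e : g = g') (e' : h = h') (k : η ≍ η') (f : b ⟶ c) : η ▷ f ≍ η' ▷ f := by
  subst e e'; rw [eq_of_heq k]

theorem id_whiskerLeft_heq {f g : a ⟶ b} (η : f ⟶ g) : 𝟙 a ◁ η ≍ η := by
  simp [Strict.leftUnitor_eqToIso]

theorem whiskerRight_id_heq {f g : a ⟶ b} (η : f ⟶ g) : η ▷ 𝟙 b ≍ η := by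
  simp [Strict.rightUnitor_eqToIso]

theorem comp_whiskerLeft_heq (f : a ⟶ b) (g : b ⟶ c) {h h' : c ⟶ d} (η : h ⟶ h') :
    (f ≫ g) ◁ η ≍ f ◁ g ◁ η := by
  simp [Strict.associator_eqToIso]

theorem whiskerRight_comp_heq {f f' : a ⟶ b} (η : f ⟶ f') (g : b ⟶ c) (h : c ⟶ d) :
    η ▷ (g ≫ h) ≍ η ▷ g ▷ h := by
  simp [Strict.associator_eqToIso]

theorem whisker_assoc_heq (f : a ⟶ b) {g g' : b ⟶ c} (η : g ⟶ g') (h : c ⟶ d) :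
    (f ◁ η) ▷ h ≍ f ◁ η ▷ h := by
  simp [Strict.associator_eqToIso]

end

/-- A 2-natural transformation whose 1-cell components are invertible is a 2-natural
isomorphism: the inverse components are 2-natural, as whiskering each naturality condition with
them on both sides shows. The given transformation is taken as the inverse direction. -/
def TwoNatIso.ofInv [Strict D] {F G : StrictPseudofunctor C D} (inv : TwoNatTrans G F)
    (hom : ∀ a, F.obj a ⟶ G.obj a) (hom_inv_id : ∀ a, hom a ≫ inv.app a = 𝟙 (F.obj a))
    (inv_hom_id : ∀ a, inv.app a ≫ hom a = 𝟙 (G.obj a)) : TwoNatIso F G where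
  hom :=
    have nat {a b : C} (f : a ⟶ b) : F.map f ≫ hom b = hom a ≫ G.map f := by
      have h := congrArg (fun t => hom a ≫ t ≫ hom b) (inv.naturality f)
      simp only [Strict.assoc, inv_hom_id, Strict.comp_id] at h
      rw [← Strict.assoc (hom a), hom_inv_id, Strict.id_comp] at h
      exact h.symm
    { app := hom
      naturality := nat
      naturality₂ {a b f g} η := by
        have h : G.map₂ η ▷ inv.app b ≍ inv.app a ◁ F.map₂ η :=
          ((comp_eqToHom_heq _ _).symm.trans (heq_of_eq (inv.naturality₂ η))).trans
            (eqToHom_comp_heq _ _)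
        -- Whisker the naturality of `inv` with `hom` on both sides and cancel `hom` against `inv`.
        have h' : hom a ◁ G.map₂ η ▷ (inv.app b ≫ hom b) ≍
            hom a ◁ (inv.app a ◁ F.map₂ η) ▷ hom b := by
          refine whiskerLeft_heq _ ?_ ?_ ((whiskerRight_comp_heq _ _ _).trans
            (whiskerRight_heq ?_ ?_ h _))
          all_goals simp only [← Strict.assoc, inv.naturality]
        have h₁ : hom a ◁ G.map₂ η ▷ (inv.app b ≫ hom b) ≍ hom a ◁ G.map₂ η := by
          rw [inv_hom_id]
          exact whiskerLeft_heq _ (Strict.comp_id _) (Strict.comp_id _) (whiskerRight_id_heq _)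
        have h₂ : hom a ◁ (inv.app a ◁ F.map₂ η) ▷ hom b ≍ F.map₂ η ▷ hom b := by
          refine (whiskerLeft_heq _ (Strict.assoc _ _ _) (Strict.assoc _ _ _)
            (whisker_assoc_heq _ _ _)).trans ((comp_whiskerLeft_heq _ _ _).symm.trans ?_)
          rw [hom_inv_id]
          exact id_whiskerLeft_heq _
        have h₃ := h₂.symm.trans (h'.symm.trans h₁)
        exact eq_of_heq ((comp_eqToHom_heq _ _).trans (h₃.trans (eqToHom_comp_heq _ _).symm)) }
  inv := inv
  hom_inv_id := hom_inv_id
  inv_hom_id := inv_hom_id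

end Strict

/-! ### Strict inverses of functors -/

section Inverse

variable {C : Type u₁} [Category.{v₁} C] {D : Type u₂} [Category.{v₂} D]

/-- The morphism corresponding to `k` under a fully faithful functor `F` with a section `g` on
objects. -/
noncomputable def strictInverseMap (F : C ⥤ D) [F.Full] (g : D → C)
    (h : ∀ y, F.obj (g y) = y) {y y' : D} (k : y ⟶ y') : g y ⟶ g y' :=
  F.preimage (eqToHom (h y) ≫ k ≫ eqToHom (h y').symm)

@[simp]
theorem map_strictInverseMap (F : C ⥤ D) [F.Full] (g : D → C)
    (h : ∀ y, F.obj (g y) = y) {y y' : D} (k : y ⟶ y') :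
    F.map (strictInverseMap F g h k) = eqToHom (h y) ≫ k ≫ eqToHom (h y').symm :=
  F.map_preimage _

/-- The strict inverse of a fully faithful functor `F` that is bijective on objects. The inverse `g`
on objects is an argument; that it is also a left inverse is needed only for
`comp_strictInverse`. -/
noncomputable def strictInverse (F : C ⥤ D) [F.Full] [F.Faithful]
    (g : D → C) (h : ∀ y, F.obj (g y) = y) : D ⥤ C where
  obj := g
  map k := strictInverseMap F g h k
  map_id y := F.map_injective (by simp)
  map_comp k k' := F.map_injective (by simp)

theorem strictInverse_comp (F : C ⥤ D) [F.Full] [F.Faithful] (g : D → C)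
    (h : ∀ y, F.obj (g y) = y) : strictInverse F g h ⋙ F = 𝟭 D :=
  CategoryTheory.Functor.ext h fun _ _ k => map_strictInverseMap F g h k

theorem comp_strictInverse (F : C ⥤ D) [F.Full] [F.Faithful] (g : D → C)
    (h : ∀ y, F.obj (g y) = y) (h' : ∀ x, g (F.obj x) = x) : F ⋙ strictInverse F g h = 𝟭 C :=
  CategoryTheory.Functor.ext h' fun x x' k => by
    have e : strictInverseMap F g h (F.map k) = eqToHom (h' x) ≫ k ≫ eqToHom (h' x').symm :=
      F.map_injective (by simp [eqToHom_map])
    exact e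

end Inverse

/-! ### Strict inverses of cartesian functors -/

section Based

variable {B : Type u₁} [Category.{v₁} B]

/-- A functor over `B` that is fully faithful and surjective on objects preserves cartesian arrows:
every test arrow into the image of a cartesian arrow comes from the source. -/
theorem isStronglyCartesian_map {𝒳 𝒴 : BasedCategory.{v, u} B} (Φ : BasedFunctor 𝒳 𝒴)
    [Φ.toFunctor.Full] [Φ.toFunctor.Faithful] (hs : Function.Surjective Φ.toFunctor.obj)
    {R S : B} (f : R ⟶ S) {a b : 𝒳.obj} (φ : a ⟶ b) (hφ : 𝒳.p.IsStronglyCartesian f φ) :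
    𝒴.p.IsStronglyCartesian f (Φ.toFunctor.map φ) where
  universal_property' {c} g ψ hψ := by
    -- As `Φ` is full and surjective on objects, `ψ` may be taken in its image.
    obtain ⟨c, rfl⟩ := hs c
    obtain ⟨ψ, rfl⟩ := Φ.toFunctor.map_surjective ψ
    have hψ' := BasedFunctor.isHomLift_map Φ (g ≫ f) ψ
    obtain ⟨χ, ⟨h₁, h₂⟩, h₃⟩ := Functor.IsStronglyCartesian.universal_property 𝒳.p f φ
      (eqToHom (Φ.w_obj c).symm ≫ g) (eqToHom (Φ.w_obj c).symm ≫ g ≫ f) (by simp) ψ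
    refine ⟨Φ.toFunctor.map χ, ⟨?_, ?_⟩, ?_⟩
    · rw [← IsHomLift.lift_eqToHom_comp_iff 𝒴.p g _ (Φ.w_obj c).symm]
      infer_instance
    · rw [← Functor.map_comp, h₂]
    · rintro θ ⟨h₄, h₅⟩
      obtain ⟨θ, rfl⟩ := Φ.toFunctor.map_surjective θ
      have h₆ := BasedFunctor.isHomLift_map Φ g θ
      rw [h₃ θ ⟨inferInstance, Φ.toFunctor.map_injective (by rw [Functor.map_comp, h₅])⟩]

/-- A functor over `B` that is fully faithful and surjective on objects, as a cartesian functor. -/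
def CartesianFunctor.ofBasedFunctor {E E' : Fibration.{v₁, v, u₁, u} B}
    (Φ : BasedFunctor E.toBasedCategory E'.toBasedCategory)
    [Φ.toFunctor.Full] [Φ.toFunctor.Faithful] (hs : Function.Surjective Φ.toFunctor.obj) :
    E ⟶ E' where
  toBasedFunctor := Φ
  map_cartesian f _ _ φ := isStronglyCartesian_map Φ hs f φ

/-- A functor over `B` that is fully faithful and bijective on objects is invertible as a
1-cell of `Fib(B)`. -/
theorem CartesianFunctor.exists_inverse {E E' : Fibration.{v₁, v, u₁, u} B} (Φ : E ⟶ E')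
    [Φ.toFunctor.Full] [Φ.toFunctor.Faithful] (hb : Function.Bijective Φ.toFunctor.obj) :
    ∃ Ψ : E' ⟶ E, Ψ ≫ Φ = 𝟙 E' ∧ Φ ≫ Ψ = 𝟙 E := by
  obtain ⟨g, hg', hg⟩ := Function.bijective_iff_has_inverse.mp hb
  have h := strictInverse_comp Φ.toFunctor g hg
  have h' := comp_strictInverse Φ.toFunctor g hg hg'
  let Ψ : BasedFunctor E'.toBasedCategory E.toBasedCategory :=
    { toFunctor := strictInverse Φ.toFunctor g hg
      w := by rw [← Φ.w, ← Functor.assoc, h, Functor.id_comp] }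
  have : Ψ.toFunctor.Full :=
    ⟨fun {y y'} k => ⟨eqToHom (hg y).symm ≫ Φ.toFunctor.map k ≫ eqToHom (hg y'),
      Φ.toFunctor.map_injective (by simp [Ψ, strictInverse])⟩⟩
  have : Ψ.toFunctor.Faithful :=
    ⟨fun {_ _} k k' e => by
      have e' := (map_strictInverseMap Φ.toFunctor g hg k).symm.trans
        ((congrArg Φ.toFunctor.map e).trans (map_strictInverseMap Φ.toFunctor g hg k'))
      exact (cancel_mono (eqToHom (hg _).symm)).mp ((cancel_epi (eqToHom (hg _))).mp e')⟩
  exact ⟨ofBasedFunctor Ψ fun x => ⟨Φ.toFunctor.obj x, hg' x⟩, ext' h, ext' h'⟩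

end Based

/-! ### The Grothendieck construction of the fibers of a fibration -/

section GrothendieckFibers

variable {B : Type u₁} [Category.{v₁} B]

theorem pbId_inv_lift {E : Fibration.{v₁, v, u₁, u} B} (b : B) (x : FiberCat E b) :
    uh (pbId b x).inv ≫ lift (𝟙 b) x = 𝟙 (und x) :=
  pbIso_hom_lift (𝟙 b) (𝟙 (und x))

/-- Functoriality of `grFibersBased`: composites in the Grothendieck construction involve the
composition constraint of the fibers, which the chosen lifts absorb. -/
theorem uh_comp_lift_comp {E : Fibration.{v₁, v, u₁, u} B} {b'' b' b : B}
    (g : b'' ⟶ b') (f : b' ⟶ b) {z : FiberCat E b''} {y : FiberCat E b'} {x : FiberCat E b}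
    (k : z ⟶ pb g y) (h : y ⟶ pb f x) :
    uh (k ≫ pbMap g h ≫ (pbComp g f x).inv) ≫ lift (g ≫ f) x =
      (uh k ≫ lift g y) ≫ uh h ≫ lift f x := by
  simp

theorem comp_lift_isHomLift {E : Fibration.{v₁, v, u₁, u} B} {b' b : B} (f : b' ⟶ b)
    {y : FiberCat E b'} {x : FiberCat E b} (h : y ⟶ pb f x) :
    E.p.IsHomLift f (uh h ≫ lift f x) := inferInstance

theorem exists_comp_lift_eq {E : Fibration.{v₁, v, u₁, u} B} {b' b : B} (f : b' ⟶ b)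
    {y : FiberCat E b'} {x : FiberCat E b} (k : und y ⟶ und x) (_ : E.p.IsHomLift f k) :
    ∃ h : y ⟶ pb f x, uh h ≫ lift f x = k :=
  ⟨fibMk (Functor.IsCartesian.map E.p f (lift f x) k),
    Functor.IsCartesian.fac E.p f (lift f x) k⟩

/-- The functor over `B` from the Grothendieck construction of the fibers of `E` to `E`:
it sends `(b, x)` to `x`, and `(f, h)` to the composite of `h` with the chosen lift of `f`. -/
noncomputable def grFibersBased (E : Fibration.{v₁, max v₁ v₂, u₁, max u₁ u₂} B) :
    BasedFunctor
      (grothendieckObj.{v₁, max v₁ v₂, u₁, max u₁ u₂} (fibersObj E)).toBasedCategory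
      E.toBasedCategory where
  obj X := und (E := E) X.fiber
  map {X Y} φ := uh (E := E) φ.fiber ≫ lift φ.base Y.fiber
  map_id X := pbId_inv_lift _ _
  map_comp {X Y Z} φ ψ := by
    refine Eq.trans ?_ (uh_comp_lift_comp φ.base ψ.base (E := E) φ.fiber ψ.fiber)
    rfl
  w := CategoryTheory.Functor.ext (fun X => und_over (E := E) X.fiber) fun X Y φ =>
    have := comp_lift_isHomLift (E := E) φ.base φ.fiber
    @IsHomLift.fac' _ _ _ _ E.p _ _ _ _ φ.base (uh (E := E) φ.fiber ≫ lift φ.base Y.fiber) this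

instance (E : Fibration.{v₁, max v₁ v₂, u₁, max u₁ u₂} B) :
    (grFibersBased E).toFunctor.Faithful where
  map_injective {X Y} φ ψ h := by
    have h₁ : E.p.IsHomLift φ.base ((grFibersBased E).toFunctor.map φ) :=
      comp_lift_isHomLift (E := E) φ.base φ.fiber
    have h₂ : E.p.IsHomLift ψ.base ((grFibersBased E).toFunctor.map ψ) :=
      comp_lift_isHomLift (E := E) ψ.base ψ.fiber
    rw [h] at h₁
    obtain ⟨f, k⟩ := φ
    obtain ⟨f', k'⟩ := ψ
    obtain rfl : f = f' :=
      (@IsHomLift.fac _ _ _ _ E.p _ _ _ _ f _ h₁).trans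
        (@IsHomLift.fac _ _ _ _ E.p _ _ _ _ f' _ h₂).symm
    exact congrArg (CoGrothendieck.Hom.mk f) (lift_cancel (E := E) h)

/-- Every object of the Grothendieck construction of the fibers is of the form `(p e, e)`, so that
arguments may assume that the equality witnessing that an object lies in a fiber is `rfl`. -/
theorem exists_eq_mk {E : Fibration.{v₁, max v₁ v₂, u₁, max u₁ u₂} B}
    (X : (grothendieckObj.{v₁, max v₁ v₂, u₁, max u₁ u₂} (fibersObj E)).obj) :
    ∃ e : E.obj, X = ⟨E.p.obj e, ⟨e, rfl⟩⟩ := by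
  match X with
  | ⟨_, ⟨e, rfl⟩⟩ => exact ⟨e, rfl⟩

instance (E : Fibration.{v₁, max v₁ v₂, u₁, max u₁ u₂} B) :
    (grFibersBased E).toFunctor.Full where
  map_surjective {X Y} k := by
    obtain ⟨y, rfl⟩ := exists_eq_mk Y
    obtain ⟨x, rfl⟩ := exists_eq_mk X
    obtain ⟨h, e⟩ := exists_comp_lift_eq (E := E) (E.p.map k) (y := ⟨x, rfl⟩) (x := ⟨y, rfl⟩) k
      (IsHomLift.map E.p k)
    exact ⟨⟨E.p.map k, h⟩, e⟩

theorem grFibersBased_bijective (E : Fibration.{v₁, max v₁ v₂, u₁, max u₁ u₂} B) :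
    Function.Bijective (grFibersBased E).toFunctor.obj := by
  refine ⟨fun X Y h => ?_, fun e => ⟨⟨E.p.obj e, ⟨e, rfl⟩⟩, rfl⟩⟩
  obtain ⟨y, rfl⟩ := exists_eq_mk Y
  obtain ⟨x, rfl⟩ := exists_eq_mk X
  obtain rfl : x = y := h
  rfl

/-- The 1-cell of `Fib(B)` given by `grFibersBased`. -/
noncomputable def grFibers (E : Fibration.{v₁, max v₁ v₂, u₁, max u₁ u₂} B) :
    grothendieckObj.{v₁, max v₁ v₂, u₁, max u₁ u₂} (fibersObj E) ⟶ E :=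
  CartesianFunctor.ofBasedFunctor (grFibersBased E) (grFibersBased_bijective E).2

theorem grFibers_exists_inverse (E : Fibration.{v₁, max v₁ v₂, u₁, max u₁ u₂} B) :
    ∃ Ψ : E ⟶ grothendieckObj.{v₁, max v₁ v₂, u₁, max u₁ u₂} (fibersObj E),
      Ψ ≫ grFibers E = 𝟙 E ∧ grFibers E ≫ Ψ = 𝟙 _ :=
  haveI : (grFibers E).toFunctor.Full := inferInstanceAs (grFibersBased E).toFunctor.Full
  haveI : (grFibers E).toFunctor.Faithful := inferInstanceAs (grFibersBased E).toFunctor.Faithful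
  CartesianFunctor.exists_inverse (grFibers E) (grFibersBased_bijective E)

/-- The comparison isomorphism of `Φ` is what makes `(f, h) ↦ h ≫ lift f x` natural in the
fibration. -/
theorem uh_comparison_comp_lift {E E' : Fibration.{v₁, v, u₁, u} B} (Φ : E ⟶ E') {b' b : B}
    (f : b' ⟶ b) {y : FiberCat E b'} {x : FiberCat E b} (h : y ⟶ pb f x) :
    uh ((fiberMap Φ b').map h ≫ (comparison Φ f x).hom) ≫ lift f ((fiberMap Φ b).obj x) =
      Φ.toFunctor.map (uh h ≫ lift f x) := by
  simp only [uh_comp, Category.assoc, comparison_hom_lift, uh_fiberMap, fiberImg_comp]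
  rfl

theorem grFibers_naturality {E E' : Fibration.{v₁, max v₁ v₂, u₁, max u₁ u₂} B} (Φ : E ⟶ E') :
    grothendieckMap.{v₁, max v₁ v₂, u₁, max u₁ u₂} (fibersMap Φ) ≫ grFibers E' =
      grFibers E ≫ Φ :=
  CartesianFunctor.ext' <| CategoryTheory.Functor.ext (fun _ => rfl) fun X Y φ =>
    (uh_comparison_comp_lift Φ φ.base (y := X.fiber) (x := Y.fiber) φ.fiber).trans
      ((Category.id_comp _).trans (Category.comp_id _)).symm

theorem grFibers_map_vert {E : Fibration.{v₁, max v₁ v₂, u₁, max u₁ u₂} B} (b : B)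
    {x y : FiberCat E b} (w : x ⟶ y) :
    (grFibers E).toFunctor.map (grVert (F := fibersObj E) w) = uh w := by
  refine (show _ = uh (w ≫ (pbId b y).inv) ≫ lift (𝟙 b) y from rfl).trans ?_
  rw [uh_comp, Category.assoc, pbId_inv_lift, Category.comp_id]

/-- A componentwise criterion for the equation of 2-cells in the definition of a 2-natural
transformation. -/
theorem hom₂_comp_eqToHom {E E' : Fibration.{v₁, v, u₁, u} B} {F G F' G' : E ⟶ E'}
    {α : F ⟶ G} {β : F' ⟶ G'} (h : G = G') (h' : F = F')
    (e : ∀ a, (toNT α).app a ≍ (toNT β).app a) : α ≫ eqToHom h = eqToHom h' ≫ β := by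
  subst h h'
  simpa using hom₂_ext fun a => eq_of_heq (e a)

variable (B) in
/-- The functors `grFibers E` form a 2-natural transformation. -/
noncomputable def grFibersTrans :
    TwoNatTrans
      ((fibers.{v₁, max v₁ v₂, u₁, max u₁ u₂} B).comp
        (grothendieck.{v₁, max v₁ v₂, u₁, max u₁ u₂} B))
      (StrictPseudofunctor.id (Fibration.{v₁, max v₁ v₂, u₁, max u₁ u₂} B)) where
  app E := grFibers E
  naturality Φ := grFibers_naturality Φ
  naturality₂ {E E' Φ Ψ} α := by
    refine hom₂_comp_eqToHom _ _ fun X => heq_of_eq ?_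
    exact grFibers_map_vert X.base (E := E') ((fiberMap₂ α X.base).app X.fiber)

end GrothendieckFibers

/-! ### Strict inverses of pseudonatural transformations -/

section StrongTransInverse

/-- Naturality of `τ` with respect to an equality of objects, with the equalities of values stated
independently. -/
theorem natTrans_app_eqToHom {C : Type u₁} [Category.{v₁} C] {D : Type u₂} [Category.{v₂} D]
    {P Q : C ⥤ D} (τ : P ⟶ Q) {x y : C} (h : x = y) (h₁ : P.obj x = P.obj y)
    (h₂ : Q.obj x = Q.obj y) : eqToHom h₁ ≫ τ.app y = τ.app x ≫ eqToHom h₂ := by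
  subst h; simp

variable {B : Type u₁} [Category.{v₁} B] {F G : Psd.{v₁, v, u₁, u} B} (η : F ⟶ G)
  {a b c : LocallyDiscrete Bᵒᵖ}

/-- The component `η_b (F f x) ⟶ G f (η_a x)` of a pseudonatural transformation `η`. -/
def natHom (f : a ⟶ b) (x : F.obj a) :
    (η.app b).toFunctor.obj ((F.map f).toFunctor.obj x) ⟶
      (G.map f).toFunctor.obj ((η.app a).toFunctor.obj x) :=
  (η.naturality f).hom.toNatTrans.app x

/-- The inverse `G f (η_a x) ⟶ η_b (F f x)` of the component of a pseudonatural
transformation `η`. -/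
def natInv (f : a ⟶ b) (x : F.obj a) :
    (G.map f).toFunctor.obj ((η.app a).toFunctor.obj x) ⟶
      (η.app b).toFunctor.obj ((F.map f).toFunctor.obj x) :=
  (η.naturality f).inv.toNatTrans.app x

@[simp] theorem natHom_natInv (f : a ⟶ b) (x : F.obj a) :
    natHom η f x ≫ natInv η f x = 𝟙 _ :=
  (Cat.Hom.toNatIso (η.naturality f)).hom_inv_id_app x

@[simp] theorem natInv_natHom (f : a ⟶ b) (x : F.obj a) :
    natInv η f x ≫ natHom η f x = 𝟙 _ :=
  (Cat.Hom.toNatIso (η.naturality f)).inv_hom_id_app x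

theorem natInv_naturality (f : a ⟶ b) {x y : F.obj a} (w : x ⟶ y) :
    (G.map f).toFunctor.map ((η.app a).toFunctor.map w) ≫ natInv η f y =
      natInv η f x ≫ (η.app b).toFunctor.map ((F.map f).toFunctor.map w) :=
  (η.naturality f).inv.toNatTrans.naturality w

/-- The component `F (1) x ⟶ x` of the unit constraint of a pseudofunctor. -/
def unitHom (F : Psd.{v₁, v, u₁, u} B) (x : F.obj a) : (F.map (𝟙 a)).toFunctor.obj x ⟶ x :=
  (F.mapId a).hom.toNatTrans.app x

/-- The component `F (f ≫ g) x ⟶ F g (F f x)` of the composition constraint of a pseudofunctor. -/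
def compHom (F : Psd.{v₁, v, u₁, u} B) (f : a ⟶ b) (g : b ⟶ c) (x : F.obj a) :
    (F.map (f ≫ g)).toFunctor.obj x ⟶ (F.map g).toFunctor.obj ((F.map f).toFunctor.obj x) :=
  (F.mapComp f g).hom.toNatTrans.app x

theorem natHom_id (x : F.obj a) :
    natHom η (𝟙 a) x ≫ unitHom G ((η.app a).toFunctor.obj x) =
      (η.app a).toFunctor.map (unitHom F x) :=
  (congrArg (fun t => t.toNatTrans.app x) (η.naturality_id a)).trans <|
    (congrArg (_ ≫ ·) (Category.comp_id _)).trans (Category.comp_id _)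

theorem natHom_comp (f : a ⟶ b) (g : b ⟶ c) (x : F.obj a) :
    natHom η (f ≫ g) x ≫ compHom G f g ((η.app a).toFunctor.obj x) =
      (η.app c).toFunctor.map (compHom F f g x) ≫ natHom η g ((F.map f).toFunctor.obj x) ≫
        (G.map g).toFunctor.map (natHom η f x) :=
  (congrArg (fun t => t.toNatTrans.app x) (η.naturality_comp f g)).trans <|
    congrArg (_ ≫ ·) <| (Category.id_comp _).trans <|
      congrArg (_ ≫ ·) <| (Category.id_comp _).trans (Category.comp_id _)

theorem natInv_id (x : F.obj a) :
    natInv η (𝟙 a) x ≫ (η.app a).toFunctor.map (unitHom F x) =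
      unitHom G ((η.app a).toFunctor.obj x) := by
  rw [← natHom_id, ← Category.assoc, natInv_natHom, Category.id_comp]

theorem natInv_comp (f : a ⟶ b) (g : b ⟶ c) (x : F.obj a) :
    natInv η (f ≫ g) x ≫ (η.app c).toFunctor.map (compHom F f g x) =
      compHom G f g ((η.app a).toFunctor.obj x) ≫
        (G.map g).toFunctor.map (natInv η f x) ≫ natInv η g ((F.map f).toFunctor.obj x) := by
  have h := natHom_comp η f g x
  have e : (G.map g).toFunctor.map (natHom η f x) ≫ (G.map g).toFunctor.map (natInv η f x) =
      𝟙 _ := by rw [← Functor.map_comp, natHom_natInv, CategoryTheory.Functor.map_id]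
  have h' := congrArg (fun t => natInv η (f ≫ g) x ≫ t ≫
    (G.map g).toFunctor.map (natInv η f x) ≫ natInv η g ((F.map f).toFunctor.obj x)) h
  simp only [Category.assoc, reassoc_of% e, natHom_natInv, Category.comp_id] at h'
  rw [← h', ← Category.assoc, natInv_natHom, Category.id_comp]

variable [∀ a, (η.app a).toFunctor.Full] [∀ a, (η.app a).toFunctor.Faithful]
  (g : ∀ a, G.obj a → F.obj a) (hg : ∀ a y, (η.app a).toFunctor.obj (g a y) = y)

/-- The naturality component at `y` of the inverse of a pseudonatural transformation `η` with
invertible components: the preimage under `η_b` of the inverse of the naturality component of `η`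
at `(η_a)⁻¹ y`. -/
noncomputable def invComponent (f : a ⟶ b) (y : G.obj a) :
    g b ((G.map f).toFunctor.obj y) ≅ (F.map f).toFunctor.obj (g a y) :=
  (η.app b).toFunctor.preimageIso
    (eqToIso ((hg b _).trans (congrArg (G.map f).toFunctor.obj (hg a y).symm)) ≪≫
      { hom := natInv η f (g a y), inv := natHom η f (g a y) })

theorem map_invComponent_hom (f : a ⟶ b) (y : G.obj a) :
    (η.app b).toFunctor.map (invComponent η g hg f y).hom =
      eqToHom ((hg b _).trans (congrArg (G.map f).toFunctor.obj (hg a y).symm)) ≫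
        natInv η f (g a y) :=
  (η.app b).toFunctor.map_preimage _

/-- Like the two lemmas below, this is checked after applying the faithful functors `η_b`, where the
components of the inverse become those of `natInv` up to transport along equalities of objects. -/
theorem invComponent_naturality (f : a ⟶ b) {y y' : G.obj a} (k : y ⟶ y') :
    strictInverseMap (η.app b).toFunctor (g b) (hg b) ((G.map f).toFunctor.map k) ≫
        (invComponent η g hg f y').hom =
      (invComponent η g hg f y).hom ≫ (F.map f).toFunctor.map
        (strictInverseMap (η.app a).toFunctor (g a) (hg a) k) := by
  refine (η.app b).toFunctor.map_injective ?_
  have h := natInv_naturality η f (strictInverseMap (η.app a).toFunctor (g a) (hg a) k)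
  rw [map_strictInverseMap] at h
  refine ((η.app b).toFunctor.map_comp _ _).trans ?_
  refine Eq.trans ?_ ((η.app b).toFunctor.map_comp _ _).symm
  rw [map_strictInverseMap, map_invComponent_hom, map_invComponent_hom, Category.assoc]
  refine Eq.trans ?_ ((congrArg (eqToHom _ ≫ ·) h).trans (Category.assoc _ _ _).symm)
  simp [eqToHom_map]

theorem invComponent_id (y : G.obj a) :
    (invComponent η g hg (𝟙 a) y).hom ≫ unitHom F (g a y) =
      strictInverseMap (η.app a).toFunctor (g a) (hg a) (unitHom G y) := by
  refine (η.app a).toFunctor.map_injective ?_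
  rw [map_strictInverseMap, Functor.map_comp, map_invComponent_hom, Category.assoc, natInv_id]
  have h := natTrans_app_eqToHom (G.mapId a).hom.toNatTrans (hg a y).symm
    (congrArg (G.map (𝟙 a)).toFunctor.obj (hg a y).symm) (hg a y).symm
  rw [← eqToHom_trans_assoc (hg a _) (congrArg (G.map (𝟙 a)).toFunctor.obj (hg a y).symm)]
  exact congrArg _ h

theorem invComponent_comp (f : a ⟶ b) (k : b ⟶ c) (y : G.obj a) :
    (invComponent η g hg (f ≫ k) y).hom ≫ compHom F f k (g a y) =
      strictInverseMap (η.app c).toFunctor (g c) (hg c) (compHom G f k y) ≫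
        (invComponent η g hg k ((G.map f).toFunctor.obj y)).hom ≫
          (F.map k).toFunctor.map (invComponent η g hg f y).hom := by
  refine (η.app c).toFunctor.map_injective ?_
  have h := natTrans_app_eqToHom (G.mapComp f k).hom.toNatTrans (hg a y).symm
    (congrArg (G.map (f ≫ k)).toFunctor.obj (hg a y).symm)
    (congrArg (fun t => (G.map k).toFunctor.obj ((G.map f).toFunctor.obj t)) (hg a y).symm)
  have h₁ := natInv_naturality η k (invComponent η g hg f y).hom
  rw [map_invComponent_hom] at h₁
  rw [Functor.map_comp, map_invComponent_hom, Category.assoc, natInv_comp]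
  refine Eq.trans ?_ ((η.app c).toFunctor.map_comp _ _).symm
  rw [map_strictInverseMap, Functor.map_comp, map_invComponent_hom, Category.assoc,
    Category.assoc, Category.assoc, ← h₁,
    ← eqToHom_trans_assoc (hg c _) (congrArg (G.map (f ≫ k)).toFunctor.obj (hg a y).symm)]
  refine congrArg _ ?_
  have h₂ := congrArg (· ≫ (G.map k).toFunctor.map (natInv η f (g a y)) ≫
    natInv η k ((F.map f).toFunctor.obj (g a y))) h
  refine ((Category.assoc _ _ _).symm.trans h₂).trans ((Category.assoc _ _ _).trans ?_)
  refine congrArg _ ?_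
  simp [eqToHom_map]

/-- The inverse of a pseudonatural transformation whose components are isomorphisms of
categories. -/
noncomputable def strongTransInverse : G ⟶ F where
  app a := (strictInverse (η.app a).toFunctor (g a) (hg a)).toCatHom
  naturality f := Cat.Hom.isoMk <|
    NatIso.ofComponents (fun y => invComponent η g hg f y)
      (fun k => invComponent_naturality η g hg f k)
  naturality_naturality {a b f f'} τ := by
    obtain rfl : f = f' := LocallyDiscrete.eq_of_hom τ
    obtain rfl : τ = 𝟙 f := Subsingleton.elim _ _
    ext y
    refine Eq.trans (b := (invComponent η g hg f y).hom) ?_ ?_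
    · refine (congrArg (· ≫ (invComponent η g hg f y).hom) ?_).trans (Category.id_comp _)
      exact (congrArg (strictInverse (η.app b).toFunctor (g b) (hg b)).map
        (map₂_id_app G f y)).trans ((strictInverse _ (g b) (hg b)).map_id _)
    · exact ((congrArg ((invComponent η g hg f y).hom ≫ ·)
        (map₂_id_app F f _)).trans (Category.comp_id _)).symm
  naturality_id a := by
    ext y
    refine (invComponent_id η g hg y).trans (Eq.symm ?_)
    exact (congrArg (_ ≫ ·) (Category.comp_id _)).trans (Category.comp_id _)
  naturality_comp {a b c} f k := by
    ext y
    refine (invComponent_comp η g hg f k y).trans (congrArg (_ ≫ ·) (Eq.symm ?_))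
    refine (Category.id_comp _).trans (congrArg (_ ≫ ·) ?_)
    exact (Category.id_comp _).trans (Category.comp_id _)

theorem strongTransInverse_comp : strongTransInverse η g hg ≫ η = 𝟙 G := by
  refine strongTrans_ext (fun a => strictInverse_comp (η.app a).toFunctor _ _) fun {a b} f y => ?_
  rw [comp_naturality_app, id_naturality_app]
  have h : (η.app b).toFunctor.map (invComponent η g hg f y).hom ≫ natHom η f (g a y) =
      eqToHom ((hg b _).trans (congrArg (G.map f).toFunctor.obj (hg a y).symm)) := by
    rw [map_invComponent_hom, Category.assoc, natInv_natHom, Category.comp_id]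
  refine (congrArg (· ≫ _) h).trans ((eqToHom_trans _ _).trans (Category.comp_id _).symm)

theorem comp_strongTransInverse (hg' : ∀ a x, g a ((η.app a).toFunctor.obj x) = x) :
    η ≫ strongTransInverse η g hg = 𝟙 F := by
  refine strongTrans_ext (fun a => comp_strictInverse (η.app a).toFunctor _ _ (hg' a))
    fun {a b} f x => ?_
  rw [comp_naturality_app, id_naturality_app]
  have h : strictInverseMap (η.app b).toFunctor (g b) (hg b) (natHom η f x) ≫
      (invComponent η g hg f ((η.app a).toFunctor.obj x)).hom =
        eqToHom ((hg' b _).trans (congrArg (F.map f).toFunctor.obj (hg' a x).symm)) := by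
    refine (η.app b).toFunctor.map_injective ?_
    have h₁ := natTrans_app_eqToHom (η.naturality f).inv.toNatTrans (hg' a x).symm
      (congrArg (fun t => (G.map f).toFunctor.obj ((η.app a).toFunctor.obj t)) (hg' a x).symm)
      (congrArg (fun t => (η.app b).toFunctor.obj ((F.map f).toFunctor.obj t)) (hg' a x).symm)
    have h₂ : natHom η f x ≫ eqToHom _ ≫ natInv η f _ = eqToHom _ :=
      (congrArg (natHom η f x ≫ ·) h₁).trans <| (Category.assoc _ _ _).symm.trans <|
        (congrArg (· ≫ _) (natHom_natInv η f x)).trans (Category.id_comp _)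
    rw [Functor.map_comp, map_strictInverseMap, map_invComponent_hom, Category.assoc,
      Category.assoc, eqToHom_trans_assoc, h₂, eqToHom_trans, eqToHom_map]
  refine (congrArg (· ≫ _) h).trans ((eqToHom_trans _ _).trans (Category.comp_id _).symm)

end StrongTransInverse

/-! ### The fibers of a Grothendieck construction -/

section FibersGrothendieck

open CoGrothendieck

variable {B : Type u₁} [Category.{v₁} B]

/-- The isomorphism of categories from `F b` to the fiber over `b` of the Grothendieck
construction of `F`. -/
def fiberIncl (F : Psd.{v₁, v, u₁, u} B) (b : B) :
    F.obj ⟨op b⟩ ⥤ FiberCat (grothendieckObj F) b where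
  obj x := ⟨⟨b, x⟩, rfl⟩
  map w := ⟨grVert w, grVert_isHomLift b w⟩
  map_id x := fib_hom_ext (grVert_id x)
  map_comp w w' := fib_hom_ext (grVert_comp_grVert w w')

instance (F : Psd.{v₁, v, u₁, u} B) (b : B) : (fiberIncl F b).Full :=
  inferInstanceAs (Functor.Fiber.inducedFunctor (comp_const F b)).Full

instance (F : Psd.{v₁, v, u₁, u} B) (b : B) : (fiberIncl F b).Faithful :=
  inferInstanceAs (Functor.Fiber.inducedFunctor (comp_const F b)).Faithful

theorem fiberIncl_bijective (F : Psd.{v₁, v, u₁, u} B) (b : B) :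
    Function.Bijective (fiberIncl F b).obj := by
  refine ⟨fun x y h => ?_, fun y => ?_⟩
  · have h' : (⟨b, x⟩ : CoGrothendieck F) = ⟨b, y⟩ := congrArg Subtype.val h
    cases h'
    rfl
  · match y with
    | ⟨⟨_, x⟩, rfl⟩ => exact ⟨x, rfl⟩

/-- The canonical cartesian arrow `(b', F f x) ⟶ (b, x)`, between objects of fibers. -/
def fibLift {F : Psd.{v₁, v, u₁, u} B} {b' b : B} (f : b' ⟶ b) (x : F.obj ⟨op b⟩) :
    und ((fiberIncl F b').obj ((F.map f.op.toLoc).toFunctor.obj x)) ⟶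
      und ((fiberIncl F b).obj x) :=
  grLift (F := F) ⟨b, x⟩ f

instance {F : Psd.{v₁, v, u₁, u} B} {b' b : B} (f : b' ⟶ b) (x : F.obj ⟨op b⟩) :
    (grothendieckObj F).p.IsStronglyCartesian f (fibLift f x) :=
  grLift_cartesian ⟨b, x⟩ f

variable {F G : Psd.{v₁, v, u₁, u} B}

/-- The factorization of `(f, w)` into a vertical arrow and the canonical cartesian arrow. -/
theorem fiberIncl_map_comp_fibLift {b' b : B} (f : b' ⟶ b) {x : F.obj ⟨op b⟩}
    {y : F.obj ⟨op b'⟩} (w : y ⟶ (F.map f.op.toLoc).toFunctor.obj x) :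
    uh ((fiberIncl F b').map w) ≫ fibLift f x = grHom (X := ⟨b', y⟩) (Y := ⟨b, x⟩) f w :=
  grVert_comp_grLift (X := ⟨b', y⟩) (Y := ⟨b, x⟩) (grHom f w)

theorem fibLift_naturality {b' b : B} (f : b' ⟶ b) {x y : F.obj ⟨op b⟩} (w : x ⟶ y) :
    uh ((fiberIncl F b').map ((F.map f.op.toLoc).toFunctor.map w)) ≫ fibLift f y =
      fibLift f x ≫ uh ((fiberIncl F b).map w) :=
  (fiberIncl_map_comp_fibLift f _).trans <| Eq.symm <|
    (comp_grVert (X := ⟨b', (F.map f.op.toLoc).toFunctor.obj x⟩) w f (𝟙 _)).trans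
      (congrArg (grHom (X := ⟨b', (F.map f.op.toLoc).toFunctor.obj x⟩) (Y := ⟨b, y⟩) f)
        (Category.id_comp ((F.map f.op.toLoc).toFunctor.map w)))

theorem fibLift_id {b : B} (x : F.obj ⟨op b⟩) :
    fibLift (𝟙 b) x = uh ((fiberIncl F b).map (unitHom F x)) := by
  refine Eq.symm (congrArg (grHom (X := ⟨b, (F.map (𝟙 b).op.toLoc).toFunctor.obj x⟩)
    (Y := ⟨b, x⟩) (𝟙 b)) ?_)
  exact (Cat.Hom.toNatIso (F.mapId ⟨op b⟩)).hom_inv_id_app x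

/-- The component `F (g ≫ f) x ⟶ F g (F f x)` of the composition constraint, for composable
arrows of `B`. -/
def opCompHom {b'' b' b : B} (g : b'' ⟶ b') (f : b' ⟶ b) (x : F.obj ⟨op b⟩) :
    (F.map (g ≫ f).op.toLoc).toFunctor.obj x ⟶
      (F.map g.op.toLoc).toFunctor.obj ((F.map f.op.toLoc).toFunctor.obj x) :=
  compHom F f.op.toLoc g.op.toLoc x

theorem fibLift_comp {b'' b' b : B} (g : b'' ⟶ b') (f : b' ⟶ b) (x : F.obj ⟨op b⟩) :
    uh ((fiberIncl F b'').map (opCompHom g f x)) ≫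
        fibLift g ((F.map f.op.toLoc).toFunctor.obj x) ≫ fibLift f x = fibLift (g ≫ f) x := by
  refine (grVert_comp (opCompHom g f x) (Y := ⟨b, x⟩) (g ≫ f)
    (𝟙 _ ≫ (F.map g.op.toLoc).toFunctor.map (𝟙 _) ≫
      (F.mapComp f.op.toLoc g.op.toLoc).inv.toNatTrans.app x)).trans ?_
  refine congrArg (grHom (X := ⟨b'', (F.map (g ≫ f).op.toLoc).toFunctor.obj x⟩)
    (Y := ⟨b, x⟩) (g ≫ f)) ?_
  rw [Category.id_comp, CategoryTheory.Functor.map_id]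
  refine (congrArg (opCompHom g f x ≫ ·) (Category.id_comp _)).trans ?_
  exact (Cat.Hom.toNatIso (F.mapComp f.op.toLoc g.op.toLoc)).hom_inv_id_app x

/-- The vertical isomorphism `(b', F f x) ≅ f^* (b, x)`. -/
noncomputable def fibComparison {b' b : B} (f : b' ⟶ b) (x : F.obj ⟨op b⟩) :
    (fiberIncl F b').obj ((F.map f.op.toLoc).toFunctor.obj x) ≅ pb f ((fiberIncl F b).obj x) :=
  pbIso f (fibLift f x)

@[simp]
theorem fibComparison_hom_lift {b' b : B} (f : b' ⟶ b) (x : F.obj ⟨op b⟩) :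
    uh (fibComparison f x).hom ≫ lift f ((fiberIncl F b).obj x) = fibLift f x :=
  pbIso_hom_lift f (fibLift f x)

@[simp]
theorem fibComparison_hom_lift_assoc {b' b : B} (f : b' ⟶ b) (x : F.obj ⟨op b⟩)
    {z : (grothendieckObj F).obj} (h : und ((fiberIncl F b).obj x) ⟶ z) :
    uh (fibComparison f x).hom ≫ lift f ((fiberIncl F b).obj x) ≫ h = fibLift f x ≫ h := by
  rw [← Category.assoc, fibComparison_hom_lift]

theorem fibComparison_naturality {b' b : B} (f : b' ⟶ b) {x y : F.obj ⟨op b⟩} (w : x ⟶ y) :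
    (fiberIncl F b').map ((F.map f.op.toLoc).toFunctor.map w) ≫ (fibComparison f y).hom =
      (fibComparison f x).hom ≫ pbMap f ((fiberIncl F b).map w) := by
  refine lift_cancel ?_
  rw [uh_comp, uh_comp, Category.assoc, Category.assoc, fibComparison_hom_lift, pbMap_lift,
    fibComparison_hom_lift_assoc]
  exact fibLift_naturality f w

theorem fibComparison_id {b : B} (x : F.obj ⟨op b⟩) :
    (fibComparison (𝟙 b) x).hom ≫ (pbId b ((fiberIncl F b).obj x)).hom =
      (fiberIncl F b).map (unitHom F x) := by
  refine fib_hom_ext ?_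
  rw [uh_comp, uh_pbId_hom, fibComparison_hom_lift]
  exact fibLift_id x

theorem fibComparison_comp {b'' b' b : B} (g : b'' ⟶ b') (f : b' ⟶ b) (x : F.obj ⟨op b⟩) :
    (fibComparison (g ≫ f) x).hom ≫ (pbComp g f ((fiberIncl F b).obj x)).hom =
      (fiberIncl F b'').map (opCompHom g f x) ≫
        (fibComparison g ((F.map f.op.toLoc).toFunctor.obj x)).hom ≫
          pbMap g (fibComparison f x).hom := by
  refine lift_cancel₂ ?_
  simp only [uh_comp, Category.assoc, pbComp_hom_lift, fibComparison_hom_lift, pbMap_lift_assoc,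
    fibComparison_hom_lift_assoc]
  exact (fibLift_comp g f x).symm

/-- The pseudonatural transformation from `F` to the fibers of its Grothendieck construction,
with components `x ↦ (b, x)`. -/
noncomputable def toFibers (F : Psd.{v₁, max v₁ v₂, u₁, max u₁ u₂} B) :
    F ⟶ fibersObj (grothendieckObj.{v₁, max v₁ v₂, u₁, max u₁ u₂} F) where
  app b := (fiberIncl F b.as.unop).toCatHom
  naturality {a b} f := Cat.Hom.isoMk <|
    NatIso.ofComponents
      (F := (F.map f).toFunctor ⋙ fiberIncl F b.as.unop)
      (G := fiberIncl F a.as.unop ⋙ reindex (grothendieckObj F) f.as.unop)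
      (fun x => fibComparison f.as.unop x)
      (fun w => fibComparison_naturality f.as.unop w)
  naturality_naturality {a b f g} τ := by
    obtain rfl : f = g := LocallyDiscrete.eq_of_hom τ
    obtain rfl : τ = 𝟙 f := Subsingleton.elim _ _
    ext x
    refine Eq.trans (b := (fibComparison f.as.unop x).hom) ?_ ?_
    · refine (congrArg (· ≫ (fibComparison f.as.unop x).hom) ?_).trans (Category.id_comp _)
      exact (congrArg (fiberIncl F b.as.unop).map (map₂_id_app F f x)).trans
        ((fiberIncl F b.as.unop).map_id _)
    · exact ((congrArg ((fibComparison f.as.unop x).hom ≫ ·)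
        (map₂_id_app (fibersObj (grothendieckObj F)) f _)).trans (Category.comp_id _)).symm
  naturality_id a := by
    ext x
    refine (fibComparison_id x).trans (Eq.symm ?_)
    exact (congrArg (_ ≫ ·) (Category.comp_id _)).trans (Category.comp_id _)
  naturality_comp {a b c} f g := by
    ext x
    refine (fibComparison_comp g.as.unop f.as.unop x).trans (congrArg (_ ≫ ·) (Eq.symm ?_))
    refine (Category.id_comp _).trans (congrArg (_ ≫ ·) ?_)
    exact (Category.id_comp _).trans (Category.comp_id _)

theorem toFibers_exists_inverse (F : Psd.{v₁, max v₁ v₂, u₁, max u₁ u₂} B) :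
    ∃ θ : fibersObj (grothendieckObj.{v₁, max v₁ v₂, u₁, max u₁ u₂} F) ⟶ F,
      θ ≫ toFibers F = 𝟙 _ ∧ toFibers F ≫ θ = 𝟙 F := by
  have (a : LocallyDiscrete Bᵒᵖ) : ((toFibers F).app a).toFunctor.Full :=
    inferInstanceAs (fiberIncl F a.as.unop).Full
  have (a : LocallyDiscrete Bᵒᵖ) : ((toFibers F).app a).toFunctor.Faithful :=
    inferInstanceAs (fiberIncl F a.as.unop).Faithful
  choose g hg' hg using fun a : LocallyDiscrete Bᵒᵖ =>
    Function.bijective_iff_has_inverse.mp (fiberIncl_bijective F a.as.unop)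
  exact ⟨strongTransInverse (toFibers F) g hg, strongTransInverse_comp (toFibers F) g hg,
    comp_strongTransInverse (toFibers F) g hg hg'⟩

/-- The pseudonaturality constraints of `toFibers` are compatible with those of a pseudonatural
transformation `α` and of the cartesian functor induced by `α`. -/
theorem fiberIncl_natHom_comp_fibComparison {F G : Psd.{v₁, v, u₁, u} B} (α : F ⟶ G) {b' b : B}
    (f : b' ⟶ b) (x : F.obj ⟨op b⟩) :
    (fiberIncl G b').map (natHom α f.op.toLoc x) ≫
        (fibComparison f ((α.app ⟨op b⟩).toFunctor.obj x)).hom =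
      (fiberMap (grothendieckMap α) b').map (fibComparison f x).hom ≫
        (comparison (grothendieckMap α) f ((fiberIncl F b).obj x)).hom := by
  refine lift_cancel ?_
  refine Eq.trans (b := uh ((fiberIncl G b').map (natHom α f.op.toLoc x)) ≫
    fibLift f ((α.app ⟨op b⟩).toFunctor.obj x)) ?_ (Eq.symm ?_)
  · rw [uh_comp, Category.assoc, fibComparison_hom_lift]
  refine (uh_comparison_comp_lift (grothendieckMap α) f (fibComparison f x).hom).trans ?_
  rw [fibComparison_hom_lift]
  refine Eq.trans ?_ (fiberIncl_map_comp_fibLift f (natHom α f.op.toLoc x)).symm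
  refine congrArg (grHom (F := G)
    (X := ⟨b', (α.app ⟨op b'⟩).toFunctor.obj ((F.map f.op.toLoc).toFunctor.obj x)⟩)
    (Y := ⟨b, (α.app ⟨op b⟩).toFunctor.obj x⟩) f) ?_
  exact (congrArg (· ≫ natHom α f.op.toLoc x) ((α.app ⟨op b'⟩).toFunctor.map_id _)).trans
    (Category.id_comp _)

theorem fiberIncl_naturality {F G : Psd.{v₁, v, u₁, u} B} (α : F ⟶ G) (b : B) :
    fiberIncl F b ⋙ fiberMap (grothendieckMap α) b = (α.app ⟨op b⟩).toFunctor ⋙ fiberIncl G b :=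
  CategoryTheory.Functor.ext (fun _ => rfl) fun _ _ w =>
    (fib_hom_ext (w := (fiberMap (grothendieckMap α) b).map ((fiberIncl F b).map w))
      (w' := (fiberIncl G b).map ((α.app ⟨op b⟩).toFunctor.map w)) (map_grVert α w)).trans
        ((Category.id_comp _).trans (Category.comp_id _)).symm

theorem toFibers_naturality {F G : Psd.{v₁, max v₁ v₂, u₁, max u₁ u₂} B} (α : F ⟶ G) :
    α ≫ toFibers G =
      toFibers F ≫ fibersMap (grothendieckMap.{v₁, max v₁ v₂, u₁, max u₁ u₂} α) := by
  refine strongTrans_ext (fun a => (fiberIncl_naturality α a.as.unop).symm) fun {a b} f x => ?_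
  refine (Category.comp_id _).trans (Eq.trans ?_ (Category.id_comp _).symm)
  rw [comp_naturality_app, comp_naturality_app]
  exact fiberIncl_natHom_comp_fibComparison α f.as.unop x

/-- A componentwise criterion for the equation of modifications in the definition of a 2-natural
transformation. -/
theorem modification_comp_eqToHom {F G : Psd.{v₁, v, u₁, u} B} {η θ η' θ' : F ⟶ G}
    {Γ : η ⟶ θ} {Γ' : η' ⟶ θ'} (h : θ = θ') (h' : η = η')
    (e : ∀ a (x : F.obj a), (Γ.as.app a).toNatTrans.app x ≍ (Γ'.as.app a).toNatTrans.app x) :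
    Γ ≫ eqToHom h = eqToHom h' ≫ Γ' := by
  subst h h'
  simpa using modification_ext fun a x => eq_of_heq (e a x)

variable (B) in
/-- The pseudonatural transformations `toFibers F` form a 2-natural transformation. -/
noncomputable def toFibersTrans :
    TwoNatTrans
      (StrictPseudofunctor.id (Psd.{v₁, max v₁ v₂, u₁, max u₁ u₂} B))
      ((grothendieck.{v₁, max v₁ v₂, u₁, max u₁ u₂} B).comp
        (fibers.{v₁, max v₁ v₂, u₁, max u₁ u₂} B)) where
  app F := toFibers F
  naturality α := toFibers_naturality α
  naturality₂ _ := modification_comp_eqToHom _ _ fun _ _ => HEq.rfl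

end FibersGrothendieck

/-! ### The 2-equivalence of fibrations and pseudofunctors -/

/-- The 2-equivalence between fibrations and pseudofunctors given by fibers and reindexing and the
Grothendieck construction. -/
noncomputable def fibersGrothendieckEquivalence (B : Type u₁) [Category.{v₁} B] :
    TwoEquivalence (Fibration.{v₁, max v₁ v₂, u₁, max u₁ u₂} B)
      (Psd.{v₁, max v₁ v₂, u₁, max u₁ u₂} B) where
  functor := fibers.{v₁, max v₁ v₂, u₁, max u₁ u₂} B
  inverse := grothendieck.{v₁, max v₁ v₂, u₁, max u₁ u₂} B
  unitIso := TwoNatIso.ofInv (grFibersTrans B)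
    (fun E => (grFibers_exists_inverse E).choose)
    (fun E => (grFibers_exists_inverse E).choose_spec.1)
    (fun E => (grFibers_exists_inverse E).choose_spec.2)
  counitIso := TwoNatIso.ofInv (toFibersTrans B)
    (fun F => (toFibers_exists_inverse F).choose)
    (fun F => (toFibers_exists_inverse F).choose_spec.1)
    (fun F => (toFibers_exists_inverse F).choose_spec.2)

end FibPsd

theorem mainTheorem4 (B : Type u₁) [Category.{v₁} B] :
    ∃ e : FibPsd.TwoEquivalence
        (FibPsd.Fibration.{v₁, max v₁ v₂, u₁, max u₁ u₂} B)
        (FibPsd.Psd.{v₁, max v₁ v₂, u₁, max u₁ u₂} B),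
      e.functor = FibPsd.fibers.{v₁, max v₁ v₂, u₁, max u₁ u₂} B ∧
      e.inverse = FibPsd.grothendieck.{v₁, max v₁ v₂, u₁, max u₁ u₂} B :=
  ⟨FibPsd.fibersGrothendieckEquivalence.{v₁, v₂, u₁, u₂} B, rfl, rfl⟩
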